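/- **Setting.** Let $F(x)=f(x)+\varphi(x)$ on $\mathbb R^n$ with $f(x)=\psi(Ax-b)$, $A\in\mathbb R^{m\times n}$, $b\in\mathbb R^m$, where $\psi:\mathbb R^m\to\mathbb R\cup\{\infty\}$ and $\varphi:\mathbb R^n\to\mathbb R\cup\{\infty\}$ are proper and lower semicontinuous. Assume that $\psi$ is (finite and) twice continuously differentiable on an open set containing $A(\Omega)-b$ for some closed $\Omega\supseteq\operatorname{dom}\varphi$, that $\varphi$ is convex and continuous on $\operatorname{dom}\varphi$, and that $\inf F>-\infty$. Put $r(x)=x-\operatorname{prox}_\varphi(x-\nabla f(x))$. A point $x\in\operatorname{dom}\varphi$ is *stationary* if $0\in\nabla f(x)+\partial\varphi(x)$, and *strongly stationary* if moreover $\nabla^2\psi(Ax-b)\succeq0$; $X^*$ is the set of strongly stationary points. **Algorithm.** Let $c_1\in(0,1)$, $c_2\in(c_1,1)$, $\sigma_1\in(0,1)$, $\sigma_2>1$, $\eta,\theta,\alpha\in(0,1)$, $a\ge1$, $0<\nu_{\min}\le\nu_0\le\overline\nu$, $0<\delta\le1$, $\tau\ge\delta$, $p_{\min}\in(0,1/2)$,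 $\kappa>1+\delta$. Start from $x^0\in\operatorname{dom}\varphi$ and $\overline r_0=\|r(x^0)\|$. For $k=0,1,2,\dots$ put $\mu_k=\nu_k\overline r_k^{\,\delta}$, $\Lambda_k=a\max\{-\lambda_{\min}(\nabla^2\psi(Ax^k-b)),0\}$, $G_k=\nabla^2f(x^k)+\Lambda_kA^\top A+\mu_kI$, $$q_k(x)=f(x^k)+\nabla f(x^k)^\top(x-x^k)+\tfrac12(x-x^k)^\top\nabla^2f(x^k)(x-x^k)+\varphi(x),$$ let $\hat q_k$ be the same expression with $G_k$ in place of $\nabla^2f(x^k)$, and put $R_k(x)=x-\operatorname{prox}_\varphi(x-\nabla f(x^k)-G_k(x-x^k))$. Let $\hat x^k$ be any point with $$\|R_k(\hat x^k)\|\le\theta\min\{\|r(x^k)\|,\|r(x^k)\|^{1+\tau}\},\qquad F(x^k)-\hat q_k(\hat x^k)\ge\tfrac{\alpha\mu_k}{2}\|\hat x^k-x^k\|^2 .$$ Let $d^k=\hat x^k-x^k$, $\mathrm{ared}_k=F(x^k)-F(\hat x^k)$, $\mathrm{pred}_k=F(x^k)-q_k(\hat x^k)$ and $\rho_k=\mathrm{ared}_k/\mathrm{pred}_k$.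 - If $\mathrm{pred}_k\le p_{\min}(1-\theta)\|d^k\|\min\{\|r(x^k)\|,\|r(x^k)\|^\kappa\}$ or $\rho_k\le c_1$, set $x^{k+1}=x^k$ and $\nu_{k+1}=\sigma_2\nu_k$. - Otherwise set $x^{k+1}=\hat x^k$, with $\nu_{k+1}=\min\{\nu_k,\overline\nu\}$ if $\rho_k\le c_2$, and $\nu_{k+1}=\min\{\max\{\sigma_1\nu_k,\nu_{\min}\},\overline\nu\}$ if $\rho_k>c_2$. - If $\|r(x^{k+1})\|\le\eta\,\overline r_k$, set $\overline r_{k+1}=\|r(x^{k+1})\|$; otherwise set $\overline r_{k+1}=\overline r_k$. Let $\mathcal K=\{0\}\cup\{k\ge1:\|r(x^k)\|\le\eta\,\overline r_{k-1}\}$. **Theorem.** Let $\{x^k\}$ be generated by this algorithm. Assume that some $x^*\in X^*$ is an accumulation point of the subsequence $\{x^k\}_{k\in\mathcal K}$, and that there are $\varepsilon,L_\psi,\beta>0$ and $q>\max\{\delta,1-\delta\}$ such that $$\|\nabla^2\psi(Ax-b)-\nabla^2\psi(Ay-b)\|\le L_\psi\|Ax-Ay\|,\qquad \beta\operatorname{dist}(x,X^*)\le\|r(x)\|^q$$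 for all $x,y\in B_\varepsilon(x^*)\cap\operatorname{dom}\varphi$. Then $x^k\to x^*$. Moreover $\|r(x^k)\|\to0$ with Q-order (at least) $\rho:=\min\{1+\tau,\delta+q\}>1$, that is, there is $C>0$ with $\|r(x^{k+1})\|\le C\|r(x^k)\|^{\rho}$ for all sufficiently large $k$. -/

import Mathlib

noncomputable section

open Filter Topology

/-- The data of the composite problem `min_x F(x) = ψ(Ax - b) + φ(x)` on `ℝⁿ`.  The matrix
`A ∈ ℝ^{m×n}` is given as a linear map between Euclidean spaces; `Aᵀ` is its adjoint. The value
`+∞` of `ψ` and `φ` is `⊤ : EReal`. -/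
structure CompositeProblem (n m : ℕ) where
  A : EuclideanSpace ℝ (Fin n) →L[ℝ] EuclideanSpace ℝ (Fin m)
  b : EuclideanSpace ℝ (Fin m)
  ψ : EuclideanSpace ℝ (Fin m) → EReal
  φ : EuclideanSpace ℝ (Fin n) → EReal

/-- The effective domain of an extended-valued function. -/
def effDom {E : Type*} (g : E → EReal) : Set E := {x | g x < ⊤}

/-- A proper function `E → ℝ ∪ {∞}`: it never takes the value `-∞` and is not identically `∞`. -/
def IsProperFun {E : Type*} (g : E → EReal) : Prop := (∀ x, g x ≠ ⊥) ∧ (effDom g).Nonempty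

/-- The Hessian of a real function on Euclidean space: the derivative of its gradient. -/
def hessian {n : ℕ} (g : EuclideanSpace ℝ (Fin n) → ℝ) (x : EuclideanSpace ℝ (Fin n)) :
    EuclideanSpace ℝ (Fin n) →L[ℝ] EuclideanSpace ℝ (Fin n) :=
  fderiv ℝ (gradient g) x

/-- The smallest (real) eigenvalue of an operator on Euclidean space; it is used for symmetric
operators only. -/
def lambdaMin {m : ℕ} (T : EuclideanSpace ℝ (Fin m) →L[ℝ] EuclideanSpace ℝ (Fin m)) : ℝ :=
  sInf {l : ℝ | Module.End.HasEigenvalue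
    (T : EuclideanSpace ℝ (Fin m) →ₗ[ℝ] EuclideanSpace ℝ (Fin m)) l}

/-- The convex subdifferential of an extended-valued function. -/
def convexSubdiff {n : ℕ} (g : EuclideanSpace ℝ (Fin n) → EReal)
    (x : EuclideanSpace ℝ (Fin n)) : Set (EuclideanSpace ℝ (Fin n)) :=
  {v | x ∈ effDom g ∧ ∀ y, g x + ((inner ℝ v (y - x) : ℝ) : EReal) ≤ g y}

/-- The proximity operator `prox_g(x) = argmin_y { g(y) + ½ ‖y - x‖² }`.  For proper, lower
semicontinuous, convex `g` the minimizer exists and is unique. -/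
def prox {n : ℕ} (g : EuclideanSpace ℝ (Fin n) → EReal) (x : EuclideanSpace ℝ (Fin n)) :
    EuclideanSpace ℝ (Fin n) :=
  Classical.epsilon fun y =>
    IsMinOn (fun z => g z + ((1 / 2 * ‖z - x‖ ^ 2 : ℝ) : EReal)) Set.univ y

namespace CompositeProblem

variable {n m : ℕ} (P : CompositeProblem n m)

/-- The smooth part `f(x) = ψ(Ax - b)`. -/
def f (x : EuclideanSpace ℝ (Fin n)) : EReal := P.ψ (P.A x - P.b)

/-- The objective `F = f + φ`. -/
def F (x : EuclideanSpace ℝ (Fin n)) : EReal := P.f x + P.φ x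

/-- The gradient `∇f(x)`. -/
def gradf (x : EuclideanSpace ℝ (Fin n)) : EuclideanSpace ℝ (Fin n) :=
  gradient (fun z => (P.f z).toReal) x

/-- The Hessian `∇²f(x)`. -/
def hessf (x : EuclideanSpace ℝ (Fin n)) :
    EuclideanSpace ℝ (Fin n) →L[ℝ] EuclideanSpace ℝ (Fin n) :=
  hessian (fun z => (P.f z).toReal) x

/-- The Hessian `∇²ψ(Ax - b)`. -/
def hessψ (x : EuclideanSpace ℝ (Fin n)) :
    EuclideanSpace ℝ (Fin m) →L[ℝ] EuclideanSpace ℝ (Fin m) :=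
  hessian (fun y => (P.ψ y).toReal) (P.A x - P.b)

/-- The standing assumptions on the composite problem. -/
structure StandingAssumptions : Prop where
  ψ_proper : IsProperFun P.ψ
  ψ_lsc : LowerSemicontinuous P.ψ
  φ_proper : IsProperFun P.φ
  φ_lsc : LowerSemicontinuous P.φ
  /-- `ψ` is (finite and) twice continuously differentiable on an open set `U ⊇ A(Ω) - b`, where
  `Ω ⊇ dom φ` is closed. -/
  ψ_smooth : ∃ (Ω : Set (EuclideanSpace ℝ (Fin n))) (U : Set (EuclideanSpace ℝ (Fin m))),
    IsClosed Ω ∧ effDom P.φ ⊆ Ω ∧ IsOpen U ∧ (∀ x ∈ Ω, P.A x - P.b ∈ U) ∧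
      (∀ y ∈ U, P.ψ y < ⊤) ∧ ContDiffOn ℝ 2 (fun y => (P.ψ y).toReal) U
  /-- `φ` is convex. -/
  φ_convex : ConvexOn ℝ (effDom P.φ) (fun x => (P.φ x).toReal)
  /-- `φ` is continuous on its domain. -/
  φ_cont : ContinuousOn P.φ (effDom P.φ)
  /-- `F` is bounded from below. -/
  F_bdd : ⊥ < ⨅ x, P.F x

/-- Stationary points: `x ∈ dom φ` with `0 ∈ ∇f(x) + ∂φ(x)`. -/
def IsStationary (x : EuclideanSpace ℝ (Fin n)) : Prop :=
  x ∈ effDom P.φ ∧ ∃ v ∈ convexSubdiff P.φ x, P.gradf x + v = 0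

/-- The set `X*` of strongly stationary points: stationary points at which `∇²ψ(Ax - b) ⪰ 0`. -/
def stronglyStationary : Set (EuclideanSpace ℝ (Fin n)) :=
  {x | P.IsStationary x ∧ (P.hessψ x).IsPositive}

/-- The residual `r(x) = x - prox_φ(x - ∇f(x))`. -/
def r (x : EuclideanSpace ℝ (Fin n)) : EuclideanSpace ℝ (Fin n) :=
  x - prox P.φ (x - P.gradf x)

/-- `Λ = a [-λ_min(∇²ψ(Ax - b))]₊` at the current iterate `x`. -/
def Lam (a : ℝ) (x : EuclideanSpace ℝ (Fin n)) : ℝ := a * max (-lambdaMin (P.hessψ x)) 0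

/-- `H = ∇²f(x) + Λ AᵀA` at the current iterate `x`. -/
def H (a : ℝ) (x : EuclideanSpace ℝ (Fin n)) :
    EuclideanSpace ℝ (Fin n) →L[ℝ] EuclideanSpace ℝ (Fin n) :=
  P.hessf x + P.Lam a x • (ContinuousLinearMap.adjoint P.A ∘L P.A)

/-- `G = H + μ I` at the current iterate `x`. -/
def G (a μ : ℝ) (x : EuclideanSpace ℝ (Fin n)) :
    EuclideanSpace ℝ (Fin n) →L[ℝ] EuclideanSpace ℝ (Fin n) :=
  P.H a x + μ • ContinuousLinearMap.id ℝ (EuclideanSpace ℝ (Fin n))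

/-- The model `f(x) + ∇f(x)ᵀ(y - x) + ½ (y - x)ᵀ B (y - x) + φ(y)` around `x` with matrix `B`. -/
def model (B : EuclideanSpace ℝ (Fin n) →L[ℝ] EuclideanSpace ℝ (Fin n))
    (x y : EuclideanSpace ℝ (Fin n)) : EReal :=
  P.f x + ((inner ℝ (P.gradf x) (y - x) + 1 / 2 * inner ℝ (y - x) (B (y - x)) : ℝ) : EReal)
    + P.φ y

/-- The unregularized model `q` around `x`, with matrix `∇²f(x)`. -/
def q (x y : EuclideanSpace ℝ (Fin n)) : EReal := P.model (P.hessf x) x y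

/-- The regularized model `q̂` around `x`, with matrix `G`. -/
def qhat (a μ : ℝ) (x y : EuclideanSpace ℝ (Fin n)) : EReal := P.model (P.G a μ x) x y

/-- The residual `R(y) = y - prox_φ(y - ∇f(x) - (H + μI)(y - x))` of the subproblem at `x`. -/
def R (a μ : ℝ) (x y : EuclideanSpace ℝ (Fin n)) : EuclideanSpace ℝ (Fin n) :=
  y - prox P.φ (y - P.gradf x - P.G a μ x (y - x))

/-- The actual reduction `F(x) - F(y)` for a candidate `y` at the current iterate `x`. -/
def ared (x y : EuclideanSpace ℝ (Fin n)) : ℝ := (P.F x - P.F y).toReal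

/-- The predicted reduction `F(x) - q(y)` for a candidate `y` at the current iterate `x`. -/
def pred (x y : EuclideanSpace ℝ (Fin n)) : ℝ := (P.F x - P.q x y).toReal

end CompositeProblem

/-- The parameters of the method with their admissible ranges. -/
structure IRPNMParams where
  c₁ : ℝ
  c₂ : ℝ
  σ₁ : ℝ
  σ₂ : ℝ
  η : ℝ
  θ : ℝ
  α : ℝ
  a : ℝ
  νmin : ℝ
  ν₀ : ℝ
  νbar : ℝ
  δ : ℝ
  τ : ℝ
  pmin : ℝ
  κ : ℝ
  hc₁ : 0 < c₁ ∧ c₁ < 1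
  hc₂ : c₁ < c₂ ∧ c₂ < 1
  hσ₁ : 0 < σ₁ ∧ σ₁ < 1
  hσ₂ : 1 < σ₂
  hη : 0 < η ∧ η < 1
  hθ : 0 < θ ∧ θ < 1
  hα : 0 < α ∧ α < 1
  ha : 1 ≤ a
  hν : 0 < νmin ∧ νmin ≤ ν₀ ∧ ν₀ ≤ νbar
  hδ : 0 < δ ∧ δ ≤ 1
  hτ : δ ≤ τ
  hpmin : 0 < pmin ∧ pmin < 1 / 2
  hκ : 1 + δ < κ

/-- The inexactness criterion for a candidate `y` at the current iterate `x` with regularization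
parameter `μ`.  (Its second part forces `y ∈ dom φ` whenever `F(x)` is finite.) -/
def InexactSolution {n m : ℕ} (P : CompositeProblem n m) (p : IRPNMParams) (μ : ℝ)
    (x y : EuclideanSpace ℝ (Fin n)) : Prop :=
  ‖P.R p.a μ x y‖ ≤ p.θ * min ‖P.r x‖ (‖P.r x‖ ^ (1 + p.τ)) ∧
    ((p.α * μ / 2 * ‖y - x‖ ^ 2 : ℝ) : EReal) ≤ P.F x - P.qhat p.a μ x y

/-- The test for an unsuccessful iteration with current iterate `x` and candidate `y`. -/
def Unsuccessful {n m : ℕ} (P : CompositeProblem n m) (p : IRPNMParams)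
    (x y : EuclideanSpace ℝ (Fin n)) : Prop :=
  P.pred x y ≤ p.pmin * (1 - p.θ) * ‖y - x‖ * min ‖P.r x‖ (‖P.r x‖ ^ p.κ) ∨
    P.ared x y / P.pred x y ≤ p.c₁

open Classical in
/-- The sequences of iterates `x`, inexact subproblem solutions `xhat` and parameters `ν`, `rbar`,
`μ` are generated by the regularized proximal Newton method. -/
structure IsIRPNMRun {n m : ℕ} (P : CompositeProblem n m) (p : IRPNMParams)
    (x xhat : ℕ → EuclideanSpace ℝ (Fin n)) (ν rbar μ : ℕ → ℝ) : Prop where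
  x_zero : x 0 ∈ effDom P.φ
  ν_zero : ν 0 = p.ν₀
  rbar_zero : rbar 0 = ‖P.r (x 0)‖
  μ_eq : ∀ k, μ k = ν k * rbar k ^ p.δ
  xhat_inexact : ∀ k, InexactSolution P p (μ k) (x k) (xhat k)
  x_succ : ∀ k, x (k + 1) = if Unsuccessful P p (x k) (xhat k) then x k else xhat k
  ν_succ : ∀ k, ν (k + 1) =
    if Unsuccessful P p (x k) (xhat k) then p.σ₂ * ν k
    else if P.ared (x k) (xhat k) / P.pred (x k) (xhat k) ≤ p.c₂ then min (ν k) p.νbar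
    else min (max (p.σ₁ * ν k) p.νmin) p.νbar
  rbar_succ : ∀ k, rbar (k + 1) =
    if ‖P.r (x (k + 1))‖ ≤ p.η * rbar k then ‖P.r (x (k + 1))‖ else rbar k

/-- The index set `𝒦`: it contains `0` and every `k + 1` with `‖r(x^{k+1})‖ ≤ η r̄_k`. -/
def indexK {n m : ℕ} (P : CompositeProblem n m) (p : IRPNMParams)
    (x : ℕ → EuclideanSpace ℝ (Fin n)) (rbar : ℕ → ℝ) : Set ℕ :=
  {k | k = 0 ∨ ∃ j, k = j + 1 ∧ ‖P.r (x (j + 1))‖ ≤ p.η * rbar j}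

end

open Filter Topology

/-! Write `s` for the residual norm at an iterate `x`, `t` for the distance from `x` to a nearby
strongly stationary `z`, `y` for the candidate and `d = ‖y - x‖`. Near the accumulation point, `s =
O(t)` because the prox is nonexpansive, and `t = O(s ^ q)` by the error bound. At indices in `𝒦`
with `s ≠ 0`, `r̄ = s` and `ν` lies in `[νmin, νbar]`, so `μ` is comparable to `s ^ δ`. Since `q >
δ`, this makes `t = O(μ)`.

The regularized Hessian `G` is `μ`-strongly monotone. Monotonicity of the subdifferential, applied
at `z` and at the perturbed candidate, bounds `μ ‖y - z‖` by a multiple of `μ t`; the inexactness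
fits into this bound because `τ ≥ δ`. Hence `d = O(t) = O(s ^ q)` (`exists_norm_step_le`).

This step bound has two consequences (`eventually_successful`). The residual at `y` is `O(s ^ (1 +
τ) + d ^ 2 + (Λ + μ) d)`. As `Λ = O(t)`, it is `O(s ^ ρ)` with `ρ > 1`. Also, `pred ≥ μ d ^ 2 / 2`
while `pred - ared = O(d ^ 3)` and `d / μ = O(s ^ (q - δ)) → 0`, so the ratio test passes; the other
test passes because `d` is at least a multiple of `s` and `κ > 1 + δ`.

For small `s` the accepted step shrinks the residual by the factor `η`, so the next index is again
in `𝒦`. The steps are then dominated by a geometric series of ratio `η ^ q`: the iterates never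
leave the neighbourhood and form a Cauchy sequence, whose limit must be the accumulation point. If
the residual vanishes, every candidate is rejected and the sequence stays constant. -/

open Filter Topology

/-! ### The proximity operator as resolvent of the subdifferential -/

section Prox

variable {n : ℕ} {g : EuclideanSpace ℝ (Fin n) → EReal}

lemma IsProperFun.coe_toReal {E : Type*} {g : E → EReal} (hg : IsProperFun g) {x : E}
    (hx : x ∈ effDom g) : (((g x).toReal : ℝ) : EReal) = g x :=
  EReal.coe_toReal (ne_of_lt hx) (hg.1 x)

lemma mem_convexSubdiff_iff_toReal (hg : IsProperFun g) {x v : EuclideanSpace ℝ (Fin n)} :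
    v ∈ convexSubdiff g x ↔ x ∈ effDom g ∧
      ∀ y ∈ effDom g, (g x).toReal + inner ℝ v (y - x) ≤ (g y).toReal := by
  constructor
  · rintro ⟨hx, h⟩
    refine ⟨hx, fun y hy => ?_⟩
    have := h y
    rw [← hg.coe_toReal hx, ← hg.coe_toReal hy] at this
    exact_mod_cast this
  · rintro ⟨hx, h⟩
    refine ⟨hx, fun y => ?_⟩
    by_cases hy : y ∈ effDom g
    · rw [← hg.coe_toReal hx, ← hg.coe_toReal hy]
      exact_mod_cast h y hy
    · have : g y = ⊤ := not_lt_top_iff.mp hy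
      rw [this]
      exact le_top

/-- The subdifferential of a proper function is monotone. -/
lemma convexSubdiff_monotone (hg : IsProperFun g) {x y v w : EuclideanSpace ℝ (Fin n)}
    (hv : v ∈ convexSubdiff g x) (hw : w ∈ convexSubdiff g y) :
    0 ≤ inner ℝ (v - w) (x - y) := by
  rw [mem_convexSubdiff_iff_toReal hg] at hv hw
  have h1 := hv.2 y hw.1
  have h2 := hw.2 x hv.1
  rw [← neg_sub x y, inner_neg_right] at h1
  rw [inner_sub_left]
  linarith

/-- A proper, lower semicontinuous function with an affine minorant attains the minimum that
defines its proximity operator. -/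
lemma exists_isMinOn_add_sq_dist (hg : IsProperFun g) (hlsc : LowerSemicontinuous g)
    {x₀ v : EuclideanSpace ℝ (Fin n)} (hv : v ∈ convexSubdiff g x₀)
    (x : EuclideanSpace ℝ (Fin n)) :
    ∃ y, IsMinOn (fun z => g z + ((1 / 2 * ‖z - x‖ ^ 2 : ℝ) : EReal)) Set.univ y := by
  rw [mem_convexSubdiff_iff_toReal hg] at hv
  obtain ⟨hx₀, hv⟩ := hv
  have hl : LowerSemicontinuous (fun z => g z + ((1 / 2 * ‖z - x‖ ^ 2 : ℝ) : EReal)) := by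
    refine hlsc.add' (Continuous.lowerSemicontinuous ?_) fun z =>
      EReal.continuousAt_add (Or.inr (EReal.coe_ne_bot _)) (Or.inr (EReal.coe_ne_top _))
    exact continuous_coe_real_ereal.comp (by fun_prop)
  -- Beyond this radius the quadratic term outweighs the affine minorant, so the objective exceeds
  -- its value at `x₀`; minimizing over the compact ball is enough.
  obtain ⟨p, -, hp⟩ := (hl.lowerSemicontinuousOn _).exists_isMinOn
    (s := Metric.closedBall x₀ (2 * (‖v‖ + ‖x₀ - x‖)))
    ⟨x₀, Metric.mem_closedBall_self (by positivity)⟩ (isCompact_closedBall _ _)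
  refine ⟨p, isMinOn_iff.mpr fun z _ => ?_⟩
  by_cases hz : z ∈ Metric.closedBall x₀ (2 * (‖v‖ + ‖x₀ - x‖))
  · exact isMinOn_iff.mp hp z hz
  refine le_trans (isMinOn_iff.mp hp x₀ (Metric.mem_closedBall_self (by positivity))) ?_
  by_cases hzd : z ∈ effDom g
  · rw [← hg.coe_toReal hx₀, ← hg.coe_toReal hzd]
    norm_cast
    have h1 := hv z hzd
    rw [Metric.mem_closedBall, not_le, dist_eq_norm] at hz
    have h2 : ‖z - x‖ ^ 2 = ‖z - x₀‖ ^ 2 + 2 * inner ℝ (z - x₀) (x₀ - x) + ‖x₀ - x‖ ^ 2 := by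
      rw [← norm_add_sq_real]
      congr 2
      abel
    have h3 := neg_le_of_abs_le (abs_real_inner_le_norm v (z - x₀))
    have h4 := neg_le_of_abs_le (abs_real_inner_le_norm (z - x₀) (x₀ - x))
    nlinarith [norm_nonneg (z - x₀), norm_nonneg v, norm_nonneg (x₀ - x)]
  · have : g z = ⊤ := not_lt_top_iff.mp hzd
    rw [this, EReal.top_add_coe]
    exact le_top

/-- A proper, lower semicontinuous, convex function that has a subgradient somewhere. -/
structure IsClosedConvexFun (g : EuclideanSpace ℝ (Fin n) → EReal) : Prop where
  proper : IsProperFun g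
  lsc : LowerSemicontinuous g
  convex : ConvexOn ℝ (effDom g) (fun x => (g x).toReal)
  exists_subgradient : ∃ x₀, (convexSubdiff g x₀).Nonempty

lemma sub_prox_mem_convexSubdiff (hg : IsClosedConvexFun g) (x : EuclideanSpace ℝ (Fin n)) :
    x - prox g x ∈ convexSubdiff g (prox g x) := by
  obtain ⟨x₀, v, hv⟩ := hg.exists_subgradient
  have hmin := Classical.epsilon_spec (exists_isMinOn_add_sq_dist hg.proper hg.lsc hv x)
  change IsMinOn _ _ (prox g x) at hmin
  set p := prox g x
  have hp : p ∈ effDom g := by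
    have h := isMinOn_iff.mp hmin x₀ (Set.mem_univ x₀)
    by_contra hp
    have hp' : g p = ⊤ := not_lt_top_iff.mp hp
    rw [hp', EReal.top_add_coe, top_le_iff, ← hg.proper.coe_toReal hv.1] at h
    exact EReal.coe_ne_top _ (by exact_mod_cast h)
  rw [mem_convexSubdiff_iff_toReal hg.proper]
  refine ⟨hp, fun y hy => ?_⟩
  -- Minimality of `p` is tested against points of the segment from `p` to `y`; after division by
  -- `t`, the limit `t → 0` removes the quadratic term.
  have key : ∀ t : ℝ, t ∈ Set.Ioo (0 : ℝ) 1 →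
      (g p).toReal + inner ℝ (x - p) (y - p) ≤ (g y).toReal + t * (1 / 2 * ‖y - p‖ ^ 2) := by
    rintro t ⟨h0, h1⟩
    have hc := hg.convex.2 hp hy (sub_nonneg.mpr h1.le) h0.le (by ring)
    have hd := hg.convex.1 hp hy (sub_nonneg.mpr h1.le) h0.le (by ring)
    have h := isMinOn_iff.mp hmin ((1 - t) • p + t • y) (Set.mem_univ _)
    rw [← hg.proper.coe_toReal hp, ← hg.proper.coe_toReal hd] at h
    norm_cast at h
    have hs : (1 - t) • p + t • y - x = t • (y - p) - (x - p) := by module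
    rw [hs, norm_sub_sq_real (t • (y - p)), norm_smul, inner_smul_left, real_inner_comm,
      norm_sub_rev p x] at h
    simp only [smul_eq_mul, Real.norm_eq_abs, mul_pow, sq_abs, conj_trivial] at h hc
    have : t * ((g p).toReal + inner ℝ (x - p) (y - p)) ≤
        t * ((g y).toReal + t * (1 / 2 * ‖y - p‖ ^ 2)) := by nlinarith
    exact le_of_mul_le_mul_left this h0
  have hlim : Tendsto (fun t : ℝ => (g y).toReal + t * (1 / 2 * ‖y - p‖ ^ 2)) (𝓝[>] 0)
      (𝓝 ((g y).toReal + 0 * (1 / 2 * ‖y - p‖ ^ 2))) :=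
    (Continuous.tendsto (by fun_prop) 0).mono_left nhdsWithin_le_nhds
  rw [zero_mul, add_zero] at hlim
  exact ge_of_tendsto hlim (by
    filter_upwards [Ioo_mem_nhdsGT (zero_lt_one (α := ℝ))] with t ht using key t ht)

/-- The proximity operator is the resolvent of the subdifferential. -/
lemma prox_eq_of_sub_mem_convexSubdiff (hg : IsClosedConvexFun g) {x p : EuclideanSpace ℝ (Fin n)}
    (h : x - p ∈ convexSubdiff g p) : prox g x = p := by
  have h1 := convexSubdiff_monotone hg.proper h (sub_prox_mem_convexSubdiff hg x)
  rw [sub_sub_sub_cancel_left, ← neg_sub, inner_neg_left, real_inner_self_eq_norm_sq] at h1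
  have h2 : ‖p - prox g x‖ = 0 := by nlinarith [sq_nonneg ‖p - prox g x‖]
  exact (sub_eq_zero.mp (norm_eq_zero.mp h2)).symm

lemma norm_prox_sub_prox_le (hg : IsClosedConvexFun g) (x y : EuclideanSpace ℝ (Fin n)) :
    ‖prox g x - prox g y‖ ≤ ‖x - y‖ := by
  have h1 := convexSubdiff_monotone hg.proper (sub_prox_mem_convexSubdiff hg x)
    (sub_prox_mem_convexSubdiff hg y)
  rw [sub_sub_sub_comm, inner_sub_left, real_inner_self_eq_norm_sq] at h1
  have h2 := real_inner_le_norm (x - y) (prox g x - prox g y)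
  by_contra! h
  nlinarith [norm_nonneg (prox g x - prox g y), norm_nonneg (x - y)]

end Prox

/-! ### Gradients, Hessians and Taylor estimates -/

section Calculus

/-- The Riesz isomorphism of a real Euclidean space as a linear equivalence. -/
noncomputable def rieszEquiv (n : ℕ) :
    EuclideanSpace ℝ (Fin n) ≃L[ℝ] StrongDual ℝ (EuclideanSpace ℝ (Fin n)) :=
  (InnerProductSpace.toDual ℝ (EuclideanSpace ℝ (Fin n))).toContinuousLinearEquiv

lemma inner_rieszEquiv_symm {n : ℕ} (l : StrongDual ℝ (EuclideanSpace ℝ (Fin n)))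
    (v : EuclideanSpace ℝ (Fin n)) : inner ℝ ((rieszEquiv n).symm l) v = l v :=
  InnerProductSpace.toDual_symm_apply

variable {n m : ℕ} {g : EuclideanSpace ℝ (Fin m) → ℝ} {U : Set (EuclideanSpace ℝ (Fin m))}

lemma hasGradientAt_two_of_contDiffOn (hg : ContDiffOn ℝ 2 g U) (hU : IsOpen U)
    {y : EuclideanSpace ℝ (Fin m)} (hy : y ∈ U) : HasGradientAt g (gradient g y) y :=
  ((hg.differentiableOn (by norm_num)).differentiableAt (hU.mem_nhds hy)).hasGradientAt

lemma hasFDerivAt_gradient_comp_of_contDiffOn (hg : ContDiffOn ℝ 2 g U) (hU : IsOpen U)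
    {y : EuclideanSpace ℝ (Fin m)} (hy : y ∈ U) :
    HasFDerivAt (gradient g)
      ((rieszEquiv m).symm.toContinuousLinearMap ∘L fderiv ℝ (fderiv ℝ g) y) y := by
  have h1 : ContDiffOn ℝ 1 (fderiv ℝ g) U := hg.fderiv_of_isOpen hU (by norm_num)
  have h2 : DifferentiableAt ℝ (fderiv ℝ g) y :=
    (h1.differentiableOn (by norm_num)).differentiableAt (hU.mem_nhds hy)
  exact (rieszEquiv m).symm.toContinuousLinearMap.hasFDerivAt.comp y h2.hasFDerivAt

lemma hasFDerivAt_gradient_of_contDiffOn (hg : ContDiffOn ℝ 2 g U) (hU : IsOpen U)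
    {y : EuclideanSpace ℝ (Fin m)} (hy : y ∈ U) :
    HasFDerivAt (gradient g) (hessian g y) y :=
  (hasFDerivAt_gradient_comp_of_contDiffOn hg hU hy).differentiableAt.hasFDerivAt

lemma hessian_inner_comm_of_contDiffOn (hg : ContDiffOn ℝ 2 g U) (hU : IsOpen U)
    {y : EuclideanSpace ℝ (Fin m)} (hy : y ∈ U) (v w : EuclideanSpace ℝ (Fin m)) :
    inner ℝ (hessian g y v) w = inner ℝ v (hessian g y w) := by
  have hsymm : IsSymmSndFDerivAt ℝ g y :=
    (hg.contDiffAt (hU.mem_nhds hy)).isSymmSndFDerivAt (by simp)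
  have h := (hasFDerivAt_gradient_comp_of_contDiffOn hg hU hy).fderiv
  have h' : ∀ v w, inner ℝ (hessian g y v) w = fderiv ℝ (fderiv ℝ g) y v w := fun v w => by
    rw [hessian, h]
    exact inner_rieszEquiv_symm _ _
  rw [h', real_inner_comm, h', hsymm]

lemma hasGradientAt_iff_rieszEquiv {v y : EuclideanSpace ℝ (Fin m)} :
    HasGradientAt g v y ↔ HasFDerivAt g (rieszEquiv m v) y := Iff.rfl

lemma hasGradientAt_comp_affine (A : EuclideanSpace ℝ (Fin n) →L[ℝ] EuclideanSpace ℝ (Fin m))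
    (b : EuclideanSpace ℝ (Fin m)) {x : EuclideanSpace ℝ (Fin n)} {g' : EuclideanSpace ℝ (Fin m)}
    (hg : HasGradientAt g g' (A x - b)) :
    HasGradientAt (fun z => g (A z - b)) (ContinuousLinearMap.adjoint A g') x := by
  rw [hasGradientAt_iff_rieszEquiv] at hg ⊢
  refine (hg.comp x (A.hasFDerivAt.sub_const b)).congr_fderiv ?_
  ext v
  exact (ContinuousLinearMap.adjoint_inner_left A v g').symm

lemma hessian_comp_affine (hg : ContDiffOn ℝ 2 g U) (hU : IsOpen U)
    (A : EuclideanSpace ℝ (Fin n) →L[ℝ] EuclideanSpace ℝ (Fin m))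
    (b : EuclideanSpace ℝ (Fin m)) {x : EuclideanSpace ℝ (Fin n)} (hx : A x - b ∈ U) :
    hessian (fun z => g (A z - b)) x =
      ContinuousLinearMap.adjoint A ∘L hessian g (A x - b) ∘L A := by
  have hV : ∀ᶠ z in 𝓝 x, A z - b ∈ U :=
    ContinuousAt.eventually_mem (by fun_prop) (hU.mem_nhds hx)
  have h1 : gradient (fun z => g (A z - b)) =ᶠ[𝓝 x]
      fun z => ContinuousLinearMap.adjoint A (gradient g (A z - b)) := by
    filter_upwards [hV] with z hz
    exact (hasGradientAt_comp_affine A b (hasGradientAt_two_of_contDiffOn hg hU hz)).gradient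
  have h2 : HasFDerivAt (fun z => A z - b) A x := A.hasFDerivAt.sub_const b
  have h3 : HasFDerivAt (fun z => gradient g (A z - b)) (hessian g (A x - b) ∘L A) x :=
    HasFDerivAt.comp (g := gradient g) x (hasFDerivAt_gradient_of_contDiffOn hg hU hx) h2
  have h4 := (ContinuousLinearMap.adjoint A).hasFDerivAt.comp x h3
  rw [hessian, h1.fderiv_eq]
  exact h4.fderiv

/-- First-order Taylor estimate for the gradient on a convex set where the Hessian is Lipschitz. -/
lemma norm_gradient_sub_le (hg : ContDiffOn ℝ 2 g U) (hU : IsOpen U)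
    {S : Set (EuclideanSpace ℝ (Fin m))} (hS : Convex ℝ S) (hSU : S ⊆ U) {L : ℝ} (hL : 0 ≤ L)
    (hLip : ∀ y ∈ S, ∀ z ∈ S, ‖hessian g y - hessian g z‖ ≤ L * ‖y - z‖)
    {x y : EuclideanSpace ℝ (Fin m)} (hx : x ∈ S) (hy : y ∈ S) :
    ‖gradient g y - gradient g x - hessian g x (y - x)‖ ≤ L * ‖y - x‖ ^ 2 := by
  have hseg : segment ℝ x y ⊆ S := hS.segment_subset hx hy
  -- The mean value inequality loses the factor `1/2` of the integral remainder, which is harmless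
  -- here.
  have h := Convex.norm_image_sub_le_of_norm_hasFDerivWithin_le' (𝕜 := ℝ) (f := gradient g)
    (f' := hessian g) (φ := hessian g x) (C := L * ‖y - x‖) (s := segment ℝ x y) (x := x) (y := y)
    (fun z hz => (hasFDerivAt_gradient_of_contDiffOn hg hU (hSU (hseg hz))).hasFDerivWithinAt)
    (fun z hz => (hLip z (hseg hz) x hx).trans
      (mul_le_mul_of_nonneg_left (norm_sub_le_of_mem_segment hz) hL))
    (convex_segment x y) (left_mem_segment ℝ x y) (right_mem_segment ℝ x y)
  rwa [mul_assoc, ← sq] at h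

/-- Second-order Taylor estimate on a convex set where the Hessian is Lipschitz. -/
lemma abs_taylor_two_sub_le (hg : ContDiffOn ℝ 2 g U) (hU : IsOpen U)
    {S : Set (EuclideanSpace ℝ (Fin m))} (hS : Convex ℝ S) (hSU : S ⊆ U) {L : ℝ} (hL : 0 ≤ L)
    (hLip : ∀ y ∈ S, ∀ z ∈ S, ‖hessian g y - hessian g z‖ ≤ L * ‖y - z‖)
    {x y : EuclideanSpace ℝ (Fin m)} (hx : x ∈ S) (hy : y ∈ S) :
    |g y - g x - inner ℝ (gradient g x) (y - x) - 1 / 2 * inner ℝ (y - x) (hessian g x (y - x))|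
      ≤ L * ‖y - x‖ ^ 3 := by
  have hseg : segment ℝ x y ⊆ S := hS.segment_subset hx hy
  set B := hessian g x with hB
  -- The gradient of the second-order remainder is the first-order remainder of the gradient.
  -- Symmetry of the Hessian merges the two halves of the quadratic term.
  have hder : ∀ z ∈ segment ℝ x y, HasFDerivWithinAt
      (fun z => g z - inner ℝ (gradient g x) (z - x) - 1 / 2 * inner ℝ (z - x) (B (z - x)))
      (rieszEquiv m (gradient g z - gradient g x - B (z - x))) (segment ℝ x y) z := by
    intro z hz
    have h1 := (hasGradientAt_iff_rieszEquiv.mp (hasGradientAt_two_of_contDiffOn hg hU (hSU (hseg hz))))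
    have h0 : HasFDerivAt (fun z => z - x) (ContinuousLinearMap.id ℝ _) z :=
      (hasFDerivAt_id z).sub_const x
    have h2 := (hasFDerivAt_const (gradient g x) z).inner ℝ h0
    have h3 := (h0.inner ℝ (B.hasFDerivAt.comp z h0)).const_mul (1 / 2 : ℝ)
    refine (((h1.sub h2).sub h3).congr_fderiv ?_).hasFDerivWithinAt
    ext v
    have hs := hessian_inner_comm_of_contDiffOn hg hU (hSU hx) (z - x) v
    have e1 : ∀ w, (rieszEquiv m w) v = inner ℝ w v := fun _ => rfl
    simp only [e1, ← hB, sub_apply, smul_apply,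
      ContinuousLinearMap.comp_apply, ContinuousLinearMap.prod_apply, fderivInnerCLM_apply,
      zero_apply, ContinuousLinearMap.id_apply, Function.comp_apply,
      inner_zero_left, smul_eq_mul, inner_sub_left (gradient g z - gradient g x),
      inner_sub_left (gradient g z)] at hs ⊢
    rw [← hs, real_inner_comm _ v]
    ring
  have h := Convex.norm_image_sub_le_of_norm_hasFDerivWithin_le (C := L * ‖y - x‖ ^ 2) hder
    (fun z hz => ?_) (convex_segment x y) (left_mem_segment ℝ x y) (right_mem_segment ℝ x y)
  · simp only [sub_self, map_zero, inner_zero_right, mul_zero, sub_zero, Real.norm_eq_abs] at h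
    convert h using 1
    · congr 1; ring
    · ring
  · have e2 : ‖rieszEquiv m (gradient g z - gradient g x - B (z - x))‖ =
      ‖gradient g z - gradient g x - B (z - x)‖ :=
      (InnerProductSpace.toDual ℝ (EuclideanSpace ℝ (Fin m))).norm_map _
    rw [e2]
    refine (norm_gradient_sub_le hg hU hS hSU hL hLip hx (hseg hz)).trans ?_
    gcongr
    exact norm_sub_le_of_mem_segment hz

end Calculus

/-! ### The smallest eigenvalue and the quadratic form -/

section LambdaMin

variable {m : ℕ} {T : EuclideanSpace ℝ (Fin m) →L[ℝ] EuclideanSpace ℝ (Fin m)}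

lemma exists_inner_eq_of_hasEigenvalue {l : ℝ}
    (hl : Module.End.HasEigenvalue
      (T : EuclideanSpace ℝ (Fin m) →ₗ[ℝ] EuclideanSpace ℝ (Fin m)) l) :
    ∃ v, 0 < ‖v‖ ∧ inner ℝ (T v) v = l * ‖v‖ ^ 2 := by
  obtain ⟨v, hv⟩ := hl.exists_hasEigenvector
  refine ⟨v, norm_pos_iff.mpr hv.2, ?_⟩
  have : T v = l • v := hv.apply_eq_smul
  rw [this, real_inner_smul_left, real_inner_self_eq_norm_sq]

/-- The sign condition on `c` covers an empty set of eigenvalues, whose `sInf` is `0`. -/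
lemma le_lambdaMin {c : ℝ} (hc : c ≤ 0) (h : ∀ v, c * ‖v‖ ^ 2 ≤ inner ℝ (T v) v) :
    c ≤ lambdaMin T := by
  refine Real.le_sInf ?_ hc
  intro l hl
  obtain ⟨v, hv, hlv⟩ := exists_inner_eq_of_hasEigenvalue hl
  have := h v
  rw [hlv] at this
  exact le_of_mul_le_mul_right this (by positivity)

/-- For a symmetric operator the infimum of the Rayleigh quotient is itself an eigenvalue. -/
lemma lambdaMin_mul_sq_le_inner (hT : ∀ v w, inner ℝ (T v) w = inner ℝ v (T w))
    (v : EuclideanSpace ℝ (Fin m)) : lambdaMin T * ‖v‖ ^ 2 ≤ inner ℝ (T v) v := by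
  rcases eq_or_ne v 0 with rfl | hv
  · simp
  have hv' : 0 < ‖v‖ := norm_pos_iff.mpr hv
  have : Nontrivial (EuclideanSpace ℝ (Fin m)) := ⟨v, 0, hv⟩
  have hbd : ∀ w, -‖T‖ * ‖w‖ ^ 2 ≤ inner ℝ (T w) w := fun w => by
    have h1 := neg_le_of_abs_le (abs_real_inner_le_norm (T w) w)
    have h2 := T.le_opNorm w
    nlinarith [norm_nonneg w]
  have heig := LinearMap.IsSymmetric.hasEigenvalue_iInf_of_finiteDimensional
    (T := (T : EuclideanSpace ℝ (Fin m) →ₗ[ℝ] EuclideanSpace ℝ (Fin m))) hT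
  have h1 : lambdaMin T ≤ _ := csInf_le ⟨-‖T‖, fun l hl => by
    obtain ⟨w, hw, hlw⟩ := exists_inner_eq_of_hasEigenvalue hl
    have := hbd w
    rw [hlw] at this
    exact le_of_mul_le_mul_right this (by positivity)⟩ heig
  have h2 := h1.trans (ciInf_le ⟨-‖T‖, by
    rintro _ ⟨w, rfl⟩
    rw [le_div_iff₀ (by have := norm_pos_iff.mpr w.2; positivity)]
    exact hbd w⟩ ⟨v, hv⟩)
  rw [le_div_iff₀ (by positivity)] at h2
  exact h2

end LambdaMin

namespace CompositeProblem

variable {n m : ℕ} {P : CompositeProblem n m}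

local notation "⟪" v ", " w "⟫" => inner ℝ v w

/-! ### Real-valued forms of the objective, models and reductions -/

section Finite

lemma StandingAssumptions.coe_f (hP : P.StandingAssumptions) {x : EuclideanSpace ℝ (Fin n)}
    (hx : x ∈ effDom P.φ) : (((P.f x).toReal : ℝ) : EReal) = P.f x := by
  obtain ⟨Ω, U, -, hΩ, -, hU, hfin, -⟩ := hP.ψ_smooth
  exact hP.ψ_proper.coe_toReal (hfin _ (hU x (hΩ hx)))

lemma StandingAssumptions.coe_F (hP : P.StandingAssumptions) {x : EuclideanSpace ℝ (Fin n)}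
    (hx : x ∈ effDom P.φ) : P.F x = (((P.f x).toReal + (P.φ x).toReal : ℝ) : EReal) := by
  rw [EReal.coe_add, hP.coe_f hx, hP.φ_proper.coe_toReal hx, F]

lemma StandingAssumptions.coe_model (hP : P.StandingAssumptions)
    (B : EuclideanSpace ℝ (Fin n) →L[ℝ] EuclideanSpace ℝ (Fin n))
    {x y : EuclideanSpace ℝ (Fin n)} (hx : x ∈ effDom P.φ) (hy : y ∈ effDom P.φ) :
    P.model B x y = (((P.f x).toReal + (⟪P.gradf x, y - x⟫ + 1 / 2 * ⟪y - x, B (y - x)⟫)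
      + (P.φ y).toReal : ℝ) : EReal) := by
  rw [EReal.coe_add, EReal.coe_add, hP.coe_f hx, hP.φ_proper.coe_toReal hy, model]

lemma StandingAssumptions.ared_eq (hP : P.StandingAssumptions)
    {x y : EuclideanSpace ℝ (Fin n)} (hx : x ∈ effDom P.φ) (hy : y ∈ effDom P.φ) :
    P.ared x y = (P.f x).toReal + (P.φ x).toReal - ((P.f y).toReal + (P.φ y).toReal) := by
  rw [ared, hP.coe_F hx, hP.coe_F hy, ← EReal.coe_sub, EReal.toReal_coe]

lemma StandingAssumptions.pred_eq (hP : P.StandingAssumptions)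
    {x y : EuclideanSpace ℝ (Fin n)} (hx : x ∈ effDom P.φ) (hy : y ∈ effDom P.φ) :
    P.pred x y = (P.φ x).toReal - (P.φ y).toReal
      - (⟪P.gradf x, y - x⟫ + 1 / 2 * ⟪y - x, P.hessf x (y - x)⟫) := by
  rw [pred, hP.coe_F hx, q, hP.coe_model _ hx hy, ← EReal.coe_sub, EReal.toReal_coe]
  ring

/-- Outside the domain the model is `⊤`, so the model decrease would be `⊥` and could not dominate a
real number. -/
lemma StandingAssumptions.mem_effDom_of_inexactSolution (hP : P.StandingAssumptions)
    {p : IRPNMParams} {μ : ℝ} {x y : EuclideanSpace ℝ (Fin n)} (hx : x ∈ effDom P.φ)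
    (h : InexactSolution P p μ x y) : y ∈ effDom P.φ := by
  by_contra hy
  have hy' : P.φ y = ⊤ := not_lt_top_iff.mp hy
  have h2 := h.2
  rw [qhat, model, hy', ← hP.coe_f hx, ← EReal.coe_add, EReal.coe_add_top, EReal.sub_top] at h2
  exact EReal.coe_ne_bot _ (le_bot_iff.mp h2)

lemma inner_G (a μ : ℝ) (x v w : EuclideanSpace ℝ (Fin n)) :
    ⟪v, P.G a μ x w⟫ = ⟪v, P.H a x w⟫ + μ * ⟪v, w⟫ := by
  simp [G, inner_add_right, real_inner_smul_right]

lemma inner_H (a : ℝ) (x v : EuclideanSpace ℝ (Fin n)) :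
    ⟪v, P.H a x v⟫ = ⟪v, P.hessf x v⟫ + P.Lam a x * ‖P.A v‖ ^ 2 := by
  simp [H, inner_add_right, real_inner_smul_right, ContinuousLinearMap.adjoint_inner_right]

lemma Lam_nonneg {a : ℝ} (ha : 1 ≤ a) (x : EuclideanSpace ℝ (Fin n)) : 0 ≤ P.Lam a x :=
  mul_nonneg (by linarith) (le_max_right _ _)

/-- The predicted reduction dominates the regularization term. -/
lemma StandingAssumptions.half_mul_sq_le_pred (hP : P.StandingAssumptions)
    {p : IRPNMParams} {μ : ℝ} (hμ : 0 ≤ μ) {x y : EuclideanSpace ℝ (Fin n)}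
    (hx : x ∈ effDom P.φ) (h : InexactSolution P p μ x y) :
    1 / 2 * μ * ‖y - x‖ ^ 2 ≤ P.pred x y := by
  have hy := hP.mem_effDom_of_inexactSolution hx h
  have h2 := h.2
  rw [qhat, hP.coe_F hx, hP.coe_model _ hx hy, ← EReal.coe_sub, EReal.coe_le_coe_iff] at h2
  rw [inner_G, inner_H, real_inner_self_eq_norm_sq] at h2
  rw [hP.pred_eq hx hy]
  -- `pred` is the decrease of the regularized model plus half of the two added curvature terms, and
  -- all three summands are nonnegative.
  have h3 := mul_nonneg (Lam_nonneg (P := P) p.ha x) (sq_nonneg ‖P.A (y - x)‖)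
  have h4 : 0 ≤ p.α * μ / 2 * ‖y - x‖ ^ 2 := by
    have := p.hα.1
    positivity
  linarith

end Finite

/-! ### Residual estimates from nonexpansiveness of the prox -/

section Residual

lemma r_eq_R (a μ : ℝ) (x : EuclideanSpace ℝ (Fin n)) : P.r x = P.R a μ x x := by
  simp [r, R]

lemma r_eq_zero_of_isStationary (hφ : IsClosedConvexFun P.φ) {z : EuclideanSpace ℝ (Fin n)}
    (hz : P.IsStationary z) : P.r z = 0 := by
  obtain ⟨-, v, hv, h⟩ := hz
  rw [eq_neg_of_add_eq_zero_right h] at hv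
  rw [r, prox_eq_of_sub_mem_convexSubdiff hφ (p := z) (by simpa using hv), sub_self]

/-- Optimality condition of the inexact subproblem: the residual perturbs both the subgradient and
the point at which it is taken. -/
lemma R_sub_mem_convexSubdiff (hφ : IsClosedConvexFun P.φ) (a μ : ℝ)
    (x y : EuclideanSpace ℝ (Fin n)) :
    P.R a μ x y - P.gradf x - P.G a μ x (y - x) ∈ convexSubdiff P.φ (y - P.R a μ x y) := by
  have h := sub_prox_mem_convexSubdiff hφ (y - P.gradf x - P.G a μ x (y - x))
  have e1 : y - P.R a μ x y = prox P.φ (y - P.gradf x - P.G a μ x (y - x)) := by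
    rw [R, sub_sub_cancel]
  rw [e1]
  convert h using 1
  rw [R]; abel

lemma norm_r_sub_r_le (hφ : IsClosedConvexFun P.φ) (x z : EuclideanSpace ℝ (Fin n)) :
    ‖P.r x - P.r z‖ ≤ 2 * ‖x - z‖ + ‖P.gradf x - P.gradf z‖ := by
  have h1 := norm_prox_sub_prox_le hφ (x - P.gradf x) (z - P.gradf z)
  have h2 : P.r x - P.r z =
    (x - z) - (prox P.φ (x - P.gradf x) - prox P.φ (z - P.gradf z)) := by simp only [r]; abel
  have h3 := norm_sub_le (x - z) (P.gradf x - P.gradf z)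
  rw [sub_sub_sub_comm] at h1
  rw [h2]
  have h4 := norm_sub_le (x - z) (prox P.φ (x - P.gradf x) - prox P.φ (z - P.gradf z))
  linarith

lemma norm_R_sub_R_le (hφ : IsClosedConvexFun P.φ) (a μ : ℝ) (x y : EuclideanSpace ℝ (Fin n)) :
    ‖P.R a μ x x - P.R a μ x y‖ ≤ (2 + ‖P.G a μ x‖) * ‖y - x‖ := by
  have h1 := norm_prox_sub_prox_le hφ (x - P.gradf x - P.G a μ x (x - x))
    (y - P.gradf x - P.G a μ x (y - x))
  have h2 : x - P.gradf x - P.G a μ x (x - x) - (y - P.gradf x - P.G a μ x (y - x))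
    = P.G a μ x (y - x) - (y - x) := by simp only [sub_self, map_zero]; abel
  rw [h2] at h1
  have h3 := norm_sub_le (P.G a μ x (y - x)) (y - x)
  have h4 := (P.G a μ x).le_opNorm (y - x)
  have h5 : P.R a μ x x - P.R a μ x y = -(y - x) - (prox P.φ (x - P.gradf x - P.G a μ x (x - x))
    - prox P.φ (y - P.gradf x - P.G a μ x (y - x))) := by simp only [R]; abel
  rw [h5]
  refine (norm_sub_le _ _).trans ?_
  rw [norm_neg]
  linarith

lemma norm_r_sub_R_le (hφ : IsClosedConvexFun P.φ) (a μ : ℝ) (x y : EuclideanSpace ℝ (Fin n)) :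
    ‖P.r y - P.R a μ x y‖ ≤ ‖P.gradf y - P.gradf x - P.G a μ x (y - x)‖ := by
  have h1 := norm_prox_sub_prox_le hφ (y - P.gradf x - P.G a μ x (y - x)) (y - P.gradf y)
  convert h1 using 2
  · simp only [r, R]; abel
  · abel

end Residual

/-! ### Local bounds near a strongly stationary point -/

/-- Uniform bounds on the smooth part of the problem and on its Hessian regularization near a
strongly stationary point. -/
structure LocalBounds (P : CompositeProblem n m) (a : ℝ) (xs : EuclideanSpace ℝ (Fin n))
    (ε L M : ℝ) : Prop where
  L_nonneg : 0 ≤ L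
  M_nonneg : 0 ≤ M
  gradf_taylor : ∀ x ∈ Metric.ball xs ε ∩ effDom P.φ, ∀ y ∈ Metric.ball xs ε ∩ effDom P.φ,
    ‖P.gradf y - P.gradf x - P.hessf x (y - x)‖ ≤ L * ‖y - x‖ ^ 2
  f_taylor : ∀ x ∈ Metric.ball xs ε ∩ effDom P.φ, ∀ y ∈ Metric.ball xs ε ∩ effDom P.φ,
    |(P.f y).toReal - (P.f x).toReal - ⟪P.gradf x, y - x⟫ - 1 / 2 * ⟪y - x, P.hessf x (y - x)⟫|
      ≤ L * ‖y - x‖ ^ 3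
  hessf_le : ∀ x ∈ Metric.ball xs ε ∩ effDom P.φ, ‖P.hessf x‖ ≤ M
  gradf_lip : ∀ x ∈ Metric.ball xs ε ∩ effDom P.φ, ∀ y ∈ Metric.ball xs ε ∩ effDom P.φ,
    ‖P.gradf x - P.gradf y‖ ≤ M * ‖x - y‖
  Lam_le : ∀ x ∈ Metric.ball xs ε ∩ effDom P.φ, ∀ z ∈ Metric.ball xs ε ∩ P.stronglyStationary,
    P.Lam a x ≤ L * ‖x - z‖
  H_nonneg : ∀ x ∈ Metric.ball xs ε ∩ effDom P.φ, ∀ v, 0 ≤ ⟪v, P.H a x v⟫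

lemma StandingAssumptions.exists_localBounds (hP : P.StandingAssumptions) {a : ℝ} (ha : 1 ≤ a)
    {xs : EuclideanSpace ℝ (Fin n)} (hxs : xs ∈ effDom P.φ) {ε Lψ : ℝ} (hε : 0 < ε)
    (hLψ : 0 < Lψ)
    (hLip : ∀ y ∈ Metric.ball xs ε ∩ effDom P.φ, ∀ z ∈ Metric.ball xs ε ∩ effDom P.φ,
      ‖P.hessψ y - P.hessψ z‖ ≤ Lψ * ‖P.A y - P.A z‖) :
    ∃ L M, P.LocalBounds a xs ε L M := by
  obtain ⟨Ω, U, -, hΩ, hUo, hU, -, hψ⟩ := hP.ψ_smooth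
  set S := Metric.ball xs ε ∩ effDom P.φ with hSdef
  set f : EuclideanSpace ℝ (Fin n) → ℝ := fun z => (P.f z).toReal with hf
  set V : Set (EuclideanSpace ℝ (Fin n)) := (fun z => P.A z - P.b) ⁻¹' U with hV
  have hVo : IsOpen V := hUo.preimage (by fun_prop)
  have hfV : ContDiffOn ℝ 2 f V :=
    hψ.comp (by fun_prop : ContDiff ℝ 2 (fun z => P.A z - P.b)).contDiffOn (fun z hz => hz)
  have hdomV : effDom P.φ ⊆ V := fun z hz => hU z (hΩ hz)
  have hSV : S ⊆ V := fun z hz => hdomV hz.2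
  have hSc : Convex ℝ S := (convex_ball xs ε).inter hP.φ_convex.1
  have hxsS : xs ∈ S := ⟨Metric.mem_ball_self hε, hxs⟩
  have hess : ∀ z ∈ V, P.hessf z = ContinuousLinearMap.adjoint P.A ∘L P.hessψ z ∘L P.A :=
    fun z hz => hessian_comp_affine hψ hUo P.A P.b hz
  have hsymm : ∀ z ∈ V, ∀ v w, ⟪P.hessψ z v, w⟫ = ⟪v, P.hessψ z w⟫ :=
    fun z hz => hessian_inner_comm_of_contDiffOn hψ hUo hz
  set L₁ := ‖P.A‖ * (Lψ * ‖P.A‖) * ‖P.A‖ with hL₁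
  have hL₁0 : 0 ≤ L₁ := by positivity
  have hA : ∀ y z, ‖P.A y - P.A z‖ ≤ ‖P.A‖ * ‖y - z‖ := fun y z => by
    rw [← map_sub]; exact P.A.le_opNorm _
  have hψL : ∀ y ∈ S, ∀ z ∈ S, ‖P.hessψ y - P.hessψ z‖ ≤ Lψ * ‖P.A‖ * ‖y - z‖ :=
    fun y hy z hz => by
      refine (hLip y hy z hz).trans ?_
      rw [mul_assoc]
      exact mul_le_mul_of_nonneg_left (hA y z) hLψ.le
  have hfL : ∀ y ∈ S, ∀ z ∈ S, ‖P.hessf y - P.hessf z‖ ≤ L₁ * ‖y - z‖ := fun y hy z hz => by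
    have h1 : P.hessf y - P.hessf z =
        ContinuousLinearMap.adjoint P.A ∘L (P.hessψ y - P.hessψ z) ∘L P.A := by
      rw [hess y (hSV hy), hess z (hSV hz)]
      ext v : 1
      simp
    rw [h1]
    calc _ ≤ ‖ContinuousLinearMap.adjoint P.A‖ * (‖P.hessψ y - P.hessψ z‖ * ‖P.A‖) :=
          (ContinuousLinearMap.opNorm_comp_le _ _).trans
            (mul_le_mul_of_nonneg_left (ContinuousLinearMap.opNorm_comp_le _ _) (norm_nonneg _))
      _ ≤ ‖P.A‖ * (Lψ * ‖P.A‖ * ‖y - z‖ * ‖P.A‖) := by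
          rw [LinearIsometryEquiv.norm_map]
          gcongr
          exact hψL y hy z hz
      _ = _ := by rw [hL₁]; ring
  have hM : ∀ z ∈ S, ‖P.hessf z‖ ≤ ‖P.hessf xs‖ + L₁ * ε := fun z hz => by
    have h1 := hfL z hz xs hxsS
    have h2 : ‖z - xs‖ ≤ ε := (mem_ball_iff_norm.mp hz.1).le
    have h3 := norm_le_norm_add_norm_sub' (P.hessf z) (P.hessf xs)
    have h4 := mul_le_mul_of_nonneg_left h2 hL₁0
    linarith
  have hL₂0 : 0 ≤ a * (Lψ * ‖P.A‖) := by positivity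
  refine ⟨L₁ + a * (Lψ * ‖P.A‖), ‖P.hessf xs‖ + L₁ * ε, ⟨by positivity, by positivity, ?_, ?_, hM,
    ?_, ?_, ?_⟩⟩
  · intro x hx y hy
    refine (norm_gradient_sub_le hfV hVo hSc hSV hL₁0 hfL hx hy).trans ?_
    exact mul_le_mul_of_nonneg_right (by linarith) (by positivity)
  · intro x hx y hy
    refine (abs_taylor_two_sub_le hfV hVo hSc hSV hL₁0 hfL hx hy).trans ?_
    exact mul_le_mul_of_nonneg_right (by linarith) (by positivity)
  · intro x hx y hy
    exact hSc.norm_image_sub_le_of_norm_hasFDerivWithin_le (f := P.gradf) (f' := P.hessf)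
      (fun z hz => (hasFDerivAt_gradient_of_contDiffOn hfV hVo (hSV hz)).hasFDerivWithinAt)
      hM hy hx
  · intro x hx z hz
    have hzS : z ∈ S := ⟨hz.1, hz.2.1.1⟩
    have h1 := hψL x hx z hzS
    -- The Hessian of `ψ` is positive semidefinite at `z`, so at `x` its negative curvature is at
    -- most the norm of the difference of the two Hessians.
    have h2 : -(Lψ * ‖P.A‖ * ‖x - z‖) ≤ lambdaMin (P.hessψ x) := by
      refine le_lambdaMin (neg_nonpos.mpr (by positivity)) fun v => ?_
      have h3 : 0 ≤ ⟪P.hessψ z v, v⟫ := hz.2.2.2 v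
      have h4 := neg_le_of_abs_le (abs_real_inner_le_norm ((P.hessψ x - P.hessψ z) v) v)
      have h5 : ‖(P.hessψ x - P.hessψ z) v‖ ≤ Lψ * ‖P.A‖ * ‖x - z‖ * ‖v‖ :=
        ((P.hessψ x - P.hessψ z).le_opNorm v).trans
          (mul_le_mul_of_nonneg_right h1 (norm_nonneg v))
      have h6 := mul_le_mul_of_nonneg_right h5 (norm_nonneg v)
      rw [sub_apply, inner_sub_left] at h4
      rw [sub_apply] at h6
      nlinarith
    calc P.Lam a x ≤ a * (Lψ * ‖P.A‖ * ‖x - z‖) :=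
          mul_le_mul_of_nonneg_left (max_le (by linarith) (by positivity)) (by linarith)
      _ ≤ _ := by nlinarith [mul_nonneg hL₁0 (norm_nonneg (x - z))]
  · intro x hx v
    have h1 : ⟪v, P.hessf x v⟫ = ⟪P.hessψ x (P.A v), P.A v⟫ := by
      rw [hess x (hSV hx), ContinuousLinearMap.comp_apply, ContinuousLinearMap.comp_apply,
        ContinuousLinearMap.adjoint_inner_right, real_inner_comm]
    have h2 := lambdaMin_mul_sq_le_inner (hsymm x (hSV hx)) (P.A v)
    rw [inner_H, h1]
    -- Here `a ≥ 1` enters: the shift `Λ` compensates all negative curvature of `ψ`.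
    have h3 : -lambdaMin (P.hessψ x) ≤ P.Lam a x :=
      (le_max_left _ _).trans (le_mul_of_one_le_left (le_max_right _ _) ha)
    nlinarith [sq_nonneg ‖P.A v‖]
-- Estimates for a single candidate
section Step

lemma norm_adjoint_apply_le (A : EuclideanSpace ℝ (Fin n) →L[ℝ] EuclideanSpace ℝ (Fin m))
    (v : EuclideanSpace ℝ (Fin n)) :
    ‖ContinuousLinearMap.adjoint A (A v)‖ ≤ ‖A‖ ^ 2 * ‖v‖ := by
  refine ((ContinuousLinearMap.adjoint A).le_opNorm _).trans ?_
  rw [LinearIsometryEquiv.norm_map, sq, mul_assoc]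
  exact mul_le_mul_of_nonneg_left (A.le_opNorm v) (norm_nonneg _)

lemma G_apply (a μ : ℝ) (x v : EuclideanSpace ℝ (Fin n)) :
    P.G a μ x v = P.hessf x v + (P.Lam a x • ContinuousLinearMap.adjoint P.A (P.A v) + μ • v) := by
  simp [G, H, add_assoc]

lemma norm_Lam_smul_add_le {a μ : ℝ} (ha : 1 ≤ a) (hμ : 0 ≤ μ) (x v : EuclideanSpace ℝ (Fin n)) :
    ‖P.Lam a x • ContinuousLinearMap.adjoint P.A (P.A v) + μ • v‖ ≤
      (P.Lam a x * ‖P.A‖ ^ 2 + μ) * ‖v‖ := by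
  have hΛ := Lam_nonneg (P := P) ha x
  refine (norm_add_le _ _).trans ?_
  rw [norm_smul, norm_smul, Real.norm_of_nonneg hΛ, Real.norm_of_nonneg hμ]
  nlinarith [mul_le_mul_of_nonneg_left (norm_adjoint_apply_le P.A v) hΛ]

lemma norm_G_le {a μ : ℝ} (ha : 1 ≤ a) (hμ : 0 ≤ μ) (x : EuclideanSpace ℝ (Fin n)) :
    ‖P.G a μ x‖ ≤ ‖P.hessf x‖ + (P.Lam a x * ‖P.A‖ ^ 2 + μ) := by
  have hΛ := Lam_nonneg (P := P) ha x
  refine ContinuousLinearMap.opNorm_le_bound _ (by positivity) fun v => ?_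
  rw [G_apply]
  refine (norm_add_le _ _).trans ?_
  have := norm_Lam_smul_add_le (P := P) ha hμ x v
  have := (P.hessf x).le_opNorm v
  linarith

variable {a ε L M : ℝ} {xs : EuclideanSpace ℝ (Fin n)}

/-- Quadratic inequality for the distance of an inexact subproblem solution to a strongly
stationary point. -/
lemma LocalBounds.mul_sq_norm_sub_le (hB : P.LocalBounds a xs ε L M)
    (hφ : IsClosedConvexFun P.φ) (ha : 1 ≤ a) {μ : ℝ} (hμ : 0 ≤ μ)
    {x : EuclideanSpace ℝ (Fin n)} (hx : x ∈ Metric.ball xs ε ∩ effDom P.φ)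
    {z : EuclideanSpace ℝ (Fin n)} (hz : z ∈ Metric.ball xs ε ∩ P.stronglyStationary)
    (y : EuclideanSpace ℝ (Fin n)) {b : ℝ}
    (hb : (L * ‖P.A‖ ^ 2 + L) * ‖x - z‖ ^ 2 + μ * ‖x - z‖ ≤ b) :
    μ * ‖y - z‖ ^ 2 ≤ ‖y - z‖ * ((1 + ‖P.G a μ x‖) * ‖P.R a μ x y‖ + b)
      + b * ‖P.R a μ x y‖ := by
  have hzS : z ∈ Metric.ball xs ε ∩ effDom P.φ := ⟨hz.1, hz.2.1.1⟩
  obtain ⟨-, v, hv, hv0⟩ := hz.2.1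
  rw [eq_neg_of_add_eq_zero_right hv0] at hv
  have hmono := convexSubdiff_monotone hφ.proper (R_sub_mem_convexSubdiff hφ a μ x y) hv
  set e := P.R a μ x y
  set w := P.gradf z - P.gradf x - P.hessf x (z - x) with hw
  -- `c` measures how far `z` is from solving the subproblem exactly: the regularization applied to
  -- `x - z`, plus the Taylor remainder of the gradient.
  set c := P.Lam a x • ContinuousLinearMap.adjoint P.A (P.A (x - z)) + μ • (x - z) + w with hc
  have hwn : ‖w‖ ≤ L * ‖x - z‖ ^ 2 := by
    rw [norm_sub_rev x z]
    exact hB.gradf_taylor x hx z hzS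
  have hcn : ‖c‖ ≤ b := by
    have h1 := norm_Lam_smul_add_le (P := P) ha hμ x (x - z)
    have h2 := hB.Lam_le x hx z hz
    have h3 := mul_le_mul_of_nonneg_right h2
      (mul_nonneg (sq_nonneg ‖P.A‖) (norm_nonneg (x - z)))
    have h4 := norm_add_le (P.Lam a x • ContinuousLinearMap.adjoint P.A (P.A (x - z)) +
      μ • (x - z)) w
    nlinarith
  have hid : e - P.gradf x - P.G a μ x (y - x) - -P.gradf z = e + c - P.G a μ x (y - z) := by
    have h1 : P.G a μ x (y - x) = P.G a μ x (y - z) - P.G a μ x (x - z) := by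
      rw [← map_sub]; congr 1; abel
    have h2 : P.hessf x (z - x) = -P.hessf x (x - z) := by rw [← map_neg, neg_sub]
    rw [h1, G_apply a μ x (x - z), hc, hw, h2]
    abel
  rw [hid, sub_right_comm y e z] at hmono
  generalize y - z = u at hmono ⊢
  simp only [inner_add_left, inner_sub_left, inner_sub_right] at hmono
  have h1 := real_inner_le_norm e u
  have h2 := real_inner_le_norm c u
  have h3 := neg_le_of_abs_le (abs_real_inner_le_norm c e)
  have h4 := real_inner_le_norm (P.G a μ x u) e
  have h5 := (P.G a μ x).le_opNorm u
  have h6 : μ * ‖u‖ ^ 2 ≤ ⟪P.G a μ x u, u⟫ := by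
    rw [real_inner_comm, inner_G, real_inner_self_eq_norm_sq]
    have := hB.H_nonneg x hx u
    linarith
  have h7 : 0 ≤ ⟪e, e⟫ := real_inner_self_nonneg
  have h8 := mul_le_mul_of_nonneg_right h5 (norm_nonneg e)
  have h9 := mul_le_mul_of_nonneg_right hcn (norm_nonneg u)
  have h10 := mul_le_mul_of_nonneg_right hcn (norm_nonneg e)
  nlinarith

/-- If the conclusion failed, then `B ≤ N * U`, so `b * e ≤ B ^ 2 ≤ N * U * B`; the constant term is
thus absorbed into the linear one, a contradiction. -/
lemma mul_le_of_mul_sq_le {μ N U B b e : ℝ} (hμN : μ ≤ N) (hU : 0 ≤ U)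
    (hB : 0 ≤ B) (hN : 0 ≤ N) (hbe : b * e ≤ B ^ 2) (h : μ * U ^ 2 ≤ U * B + b * e) :
    μ * U ≤ (1 + N) * B := by
  by_contra! hlt
  have h1 : B ≤ N * U := by nlinarith [mul_le_mul_of_nonneg_right hμN hU, mul_nonneg hN hB]
  have hU' : 0 < U := by
    rcases hU.eq_or_lt with h0 | h0
    · rw [← h0] at hlt
      nlinarith [mul_nonneg hN hB]
    · exact h0
  have h2 := mul_lt_mul_of_pos_right hlt hU'
  have h3 := mul_le_mul_of_nonneg_right h1 hB
  nlinarith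

lemma LocalBounds.norm_r_le (hB : P.LocalBounds a xs ε L M) (hφ : IsClosedConvexFun P.φ)
    {x : EuclideanSpace ℝ (Fin n)} (hx : x ∈ Metric.ball xs ε ∩ effDom P.φ)
    {z : EuclideanSpace ℝ (Fin n)} (hz : z ∈ Metric.ball xs ε ∩ P.stronglyStationary) :
    ‖P.r x‖ ≤ (2 + M) * ‖x - z‖ := by
  have h1 := norm_r_sub_r_le hφ x z
  rw [r_eq_zero_of_isStationary hφ hz.2.1, sub_zero] at h1
  have h2 := hB.gradf_lip x hx z ⟨hz.1, hz.2.1.1⟩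
  linarith

lemma LocalBounds.norm_r_candidate_le (hB : P.LocalBounds a xs ε L M)
    (hφ : IsClosedConvexFun P.φ) (ha : 1 ≤ a) {μ : ℝ} (hμ : 0 ≤ μ)
    {x : EuclideanSpace ℝ (Fin n)} (hx : x ∈ Metric.ball xs ε ∩ effDom P.φ)
    {y : EuclideanSpace ℝ (Fin n)} (hy : y ∈ Metric.ball xs ε ∩ effDom P.φ) :
    ‖P.r y‖ ≤ ‖P.R a μ x y‖ + L * ‖y - x‖ ^ 2 + (P.Lam a x * ‖P.A‖ ^ 2 + μ) * ‖y - x‖ := by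
  have h1 := norm_r_sub_R_le hφ a μ x y
  have h2 := norm_le_norm_add_norm_sub' (P.r y) (P.R a μ x y)
  have h3 := hB.gradf_taylor x hx y hy
  have h4 := norm_Lam_smul_add_le (P := P) ha hμ x (y - x)
  rw [G_apply, ← sub_sub] at h1
  have h5 := norm_sub_le (P.gradf y - P.gradf x - P.hessf x (y - x))
    (P.Lam a x • ContinuousLinearMap.adjoint P.A (P.A (y - x)) + μ • (y - x))
  linarith

/-- The subproblem residual starts at `r x` and must fall by the factor `θ`; being Lipschitz, it
forces a step at least proportional to `‖r x‖`. -/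
lemma one_sub_mul_norm_r_le (hφ : IsClosedConvexFun P.φ) {p : IRPNMParams} {μ : ℝ}
    {x y : EuclideanSpace ℝ (Fin n)} (h : InexactSolution P p μ x y) :
    (1 - p.θ) * ‖P.r x‖ ≤ (2 + ‖P.G p.a μ x‖) * ‖y - x‖ := by
  have h1 := norm_R_sub_R_le hφ p.a μ x y
  rw [← r_eq_R] at h1
  have h2 := norm_le_norm_add_norm_sub' (P.r x) (P.R p.a μ x y)
  have h3 := h.1.trans (mul_le_mul_of_nonneg_left (min_le_left _ _) p.hθ.1.le)
  linarith

lemma LocalBounds.abs_pred_sub_ared_le (hB : P.LocalBounds a xs ε L M)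
    (hP : P.StandingAssumptions)
    {x : EuclideanSpace ℝ (Fin n)} (hx : x ∈ Metric.ball xs ε ∩ effDom P.φ)
    {y : EuclideanSpace ℝ (Fin n)} (hy : y ∈ Metric.ball xs ε ∩ effDom P.φ) :
    |P.pred x y - P.ared x y| ≤ L * ‖y - x‖ ^ 3 := by
  rw [hP.pred_eq hx.2 hy.2, hP.ared_eq hx.2 hy.2]
  convert hB.f_taylor x hx y hy using 2
  ring

/-- At a strongly stationary limit point with zero residual every candidate is rejected. -/
lemma LocalBounds.unsuccessful_of_r_eq_zero (hB : P.LocalBounds a xs ε L M)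
    (hP : P.StandingAssumptions) (hφ : IsClosedConvexFun P.φ) (p : IRPNMParams)
    {x y : EuclideanSpace ℝ (Fin n)} (hx : x ∈ Metric.ball xs ε ∩ effDom P.φ)
    (hy : y ∈ effDom P.φ) (hr : P.r x = 0) (hne : P.stronglyStationary.Nonempty)
    (hdist : Metric.infDist x P.stronglyStationary ≤ 0) : Unsuccessful P p x y := by
  -- With zero residual the threshold of the first test is `0`, so `pred ≤ 0` is to be shown.
  left
  have hκ : p.κ ≠ 0 := by have := p.hκ; have := p.hδ.1; linarith
  rw [hr, norm_zero, Real.zero_rpow hκ, min_self, mul_zero, hP.pred_eq hx.2 hy]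
  -- `x` need not itself be strongly stationary, but strongly stationary points come arbitrarily
  -- close, which forces `Λ` to vanish. Then `H` reduces to the Hessian of `f`, which is therefore
  -- positive semidefinite.
  have hΛ : P.Lam a x ≤ 0 := by
    refine le_of_forall_pos_le_add fun γ hγ => ?_
    have hgap : 0 < ε - dist x xs := sub_pos.mpr hx.1
    have hL : 0 < L + 1 := by linarith [hB.L_nonneg]
    obtain ⟨z, hz, hxz⟩ := (Metric.infDist_lt_iff hne).mp
      (hdist.trans_lt (lt_min hgap (div_pos hγ hL)))
    have hzb : z ∈ Metric.ball xs ε := by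
      have h1 := dist_triangle_left z xs x
      have h2 := lt_of_lt_of_le hxz (min_le_left _ _)
      rw [Metric.mem_ball]
      linarith
    have h1 := hB.Lam_le x hx z ⟨hzb, hz⟩
    have h2 := lt_of_lt_of_le hxz (min_le_right _ _)
    rw [lt_div_iff₀ hL, dist_eq_norm] at h2
    nlinarith [norm_nonneg (x - z)]
  have h1 := hB.H_nonneg x hx (y - x)
  rw [inner_H] at h1
  have h2 := mul_nonneg (neg_nonneg.mpr hΛ) (sq_nonneg ‖P.A (y - x)‖)
  have h3 := sub_prox_mem_convexSubdiff hφ (x - P.gradf x)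
  have h4 : prox P.φ (x - P.gradf x) = x := (sub_eq_zero.mp hr).symm
  rw [h4, sub_sub_cancel_left, mem_convexSubdiff_iff_toReal hφ.proper] at h3
  have h5 := h3.2 y hy
  rw [inner_neg_left] at h5
  linarith

lemma eventually_mul_rpow_lt (c : ℝ) {e T : ℝ} (he : 0 < e) (hT : 0 < T) :
    ∀ᶠ s : ℝ in 𝓝[>] 0, c * s ^ e < T := by
  have h : Tendsto (fun s : ℝ => c * s ^ e) (𝓝 0) (𝓝 (c * 0 ^ e)) :=
    ((Real.continuousAt_rpow_const 0 e (Or.inr he.le)).tendsto).const_mul c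
  rw [Real.zero_rpow he.ne', mul_zero] at h
  exact (h.eventually_lt_const hT).filter_mono nhdsWithin_le_nhds

end Step

/-! ### Step length and acceptance under the error bound -/

section StepBound

variable {ε L M β q : ℝ} {xs : EuclideanSpace ℝ (Fin n)} {p : IRPNMParams}

/-- Under the error bound, a point with nonzero residual close to `xs` has a strongly stationary
point at distance at most a multiple of the `q`-th power of the residual. -/
lemma LocalBounds.exists_near_stronglyStationary (hB : P.LocalBounds p.a xs ε L M)
    (hφ : IsClosedConvexFun P.φ) (hε : 0 < ε) (hxs : xs ∈ P.stronglyStationary)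
    (hβ : 0 < β)
    (hEB : ∀ y ∈ Metric.ball xs ε ∩ effDom P.φ,
      β * Metric.infDist y P.stronglyStationary ≤ ‖P.r y‖ ^ q)
    {x : EuclideanSpace ℝ (Fin n)} (hx : x ∈ effDom P.φ) (hxε : dist x xs < ε / 4)
    (hr : 0 < ‖P.r x‖) :
    ∃ z ∈ Metric.ball xs ε ∩ P.stronglyStationary,
      ‖x - z‖ < ε / 2 ∧ ‖x - z‖ ≤ 2 / β * ‖P.r x‖ ^ q := by
  have hxb : x ∈ Metric.ball xs ε := by rw [Metric.mem_ball]; linarith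
  have hball : ∀ z, dist x z < ε / 2 → z ∈ Metric.ball xs ε := fun z hz => by
    have := dist_triangle_left z xs x
    rw [Metric.mem_ball]
    linarith
  have hne : P.stronglyStationary.Nonempty := ⟨xs, hxs⟩
  have h2M : 0 < 2 + M := by linarith [hB.M_nonneg]
  -- Positivity of the distance allows a point within twice the infimum, in place of a nearest
  -- point, which may not exist.
  have hpos : 0 < Metric.infDist x P.stronglyStationary := by
    by_contra! h0
    obtain ⟨z, hz, hxz⟩ := (Metric.infDist_lt_iff hne).mp
      (h0.trans_lt (lt_min (half_pos hε) (div_pos hr h2M)))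
    have h1 := hB.norm_r_le hφ ⟨hxb, hx⟩ ⟨hball z (hxz.trans_le (min_le_left _ _)), hz⟩
    have h2 := hxz.trans_le (min_le_right _ _)
    rw [lt_div_iff₀ h2M, dist_eq_norm] at h2
    linarith
  obtain ⟨z, hz, hxz⟩ := (Metric.infDist_lt_iff hne).mp
    (show Metric.infDist x P.stronglyStationary < 2 * Metric.infDist x P.stronglyStationary by
      linarith)
  have h1 : Metric.infDist x P.stronglyStationary ≤ dist x xs := Metric.infDist_le_dist_of_mem hxs
  have h2 : dist x z < ε / 2 := by linarith
  refine ⟨z, ⟨hball z h2, hz⟩, by rwa [← dist_eq_norm], ?_⟩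
  have h3 := hEB x ⟨hxb, hx⟩
  rw [div_mul_eq_mul_div, le_div_iff₀ hβ, ← dist_eq_norm]
  nlinarith

/-- The step to an inexact subproblem solution is bounded by the distance to the strongly
stationary points. -/
lemma LocalBounds.exists_norm_step_le (hB : P.LocalBounds p.a xs ε L M)
    (hφ : IsClosedConvexFun P.φ) (hε : 0 < ε) (hβ : 0 < β) (hq : p.δ < q) :
    ∃ C Γ : ℝ, 0 ≤ C ∧ 0 ≤ Γ ∧ ∀ x ∈ Metric.ball xs ε ∩ effDom P.φ,
      ∀ z ∈ Metric.ball xs ε ∩ P.stronglyStationary, ∀ (ν : ℝ) (y : EuclideanSpace ℝ (Fin n)),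
      0 < ‖P.r x‖ → ‖P.r x‖ ≤ 1 → ‖x - z‖ < ε / 2 → ‖x - z‖ ≤ 2 / β * ‖P.r x‖ ^ q →
      p.νmin ≤ ν → ν ≤ p.νbar → InexactSolution P p (ν * ‖P.r x‖ ^ p.δ) x y →
      ‖y - x‖ ≤ C * ‖x - z‖ ∧ ‖P.G p.a (ν * ‖P.r x‖ ^ p.δ) x‖ ≤ Γ := by
  have hL := hB.L_nonneg
  have hM := hB.M_nonneg
  have hνmin := p.hν.1
  have hνbar : 0 < p.νbar := by linarith [p.hν.2.1, p.hν.2.2]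
  set Γ := M + (L * ε * ‖P.A‖ ^ 2 + p.νbar) with hΓ
  have hΓ0 : 0 ≤ Γ := by positivity
  set L₁ := L * ‖P.A‖ ^ 2 + L with hL₁
  have hL₁0 : 0 ≤ L₁ := by positivity
  set c := 2 / β / p.νmin with hc
  have hc0 : 0 < c := by positivity
  set K := (1 + Γ) * ((2 + M) / p.νmin) + (L₁ * c + 1) with hK
  have hK0 : 0 ≤ K := by positivity
  refine ⟨(1 + p.νbar) * K + 1, Γ, by positivity, hΓ0, ?_⟩
  intro x hx z hz ν y hs hs1 htε ht hν1 hν2 hy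
  set s := ‖P.r x‖
  set t := ‖x - z‖
  have ht0 : 0 ≤ t := norm_nonneg _
  set sδ := s ^ p.δ with hsδ
  have hsδ0 : 0 < sδ := Real.rpow_pos_of_pos hs _
  have hsδ1 : sδ ≤ 1 := Real.rpow_le_one hs.le hs1 p.hδ.1.le
  set μ := ν * sδ with hμ
  have hν0 : 0 < ν := by linarith
  have hμ0 : 0 < μ := by positivity
  have hμmin : p.νmin * sδ ≤ μ := mul_le_mul_of_nonneg_right hν1 hsδ0.le
  have hμbar : μ ≤ p.νbar := (mul_le_of_le_one_right hν0.le hsδ1).trans hν2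
  have hΛt := hB.Lam_le x hx z hz
  have hG : ‖P.G p.a μ x‖ ≤ Γ := by
    have h1 := norm_G_le (P := P) p.ha hμ0.le x
    have h2 := hB.hessf_le x hx
    have h3 : P.Lam p.a x ≤ L * ε :=
      hΛt.trans (mul_le_mul_of_nonneg_left (by linarith) hL)
    have h4 := mul_le_mul_of_nonneg_right h3 (sq_nonneg ‖P.A‖)
    linarith
  refine ⟨?_, hG⟩
  have hst := hB.norm_r_le hφ hx hz
  -- From `τ ≥ δ`: the inexactness is at most `s * s ^ δ`, with `s = O(t)` and `s ^ δ = O(μ)`.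
  have he : ‖P.R p.a μ x y‖ ≤ (2 + M) / p.νmin * (μ * t) := by
    have h1 : s ^ (1 + p.τ) ≤ s * sδ := by
      rw [hsδ, ← Real.rpow_one_add' hs.le (by linarith [p.hδ.1])]
      exact Real.rpow_le_rpow_of_exponent_ge hs hs1 (by linarith [p.hτ])
    have h2 : ‖P.R p.a μ x y‖ ≤ s ^ (1 + p.τ) :=
      hy.1.trans ((mul_le_of_le_one_left (le_min hs.le (Real.rpow_nonneg hs.le _))
        p.hθ.2.le).trans (min_le_right _ _))
    rw [div_mul_eq_mul_div, le_div_iff₀ hνmin]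
    calc ‖P.R p.a μ x y‖ * p.νmin ≤ s * sδ * p.νmin :=
          mul_le_mul_of_nonneg_right (h2.trans h1) hνmin.le
      _ = s * (p.νmin * sδ) := by ring
      _ ≤ ((2 + M) * t) * μ := mul_le_mul hst hμmin (by positivity) (by positivity)
      _ = _ := by ring
  -- From `q > δ`: this turns the quadratic error `t ^ 2` into `O(μ * t)`, so that `μ` cancels at
  -- the end.
  have htμ : t ≤ c * μ := by
    have h1 : s ^ q ≤ sδ := Real.rpow_le_rpow_of_exponent_ge hs hs1 hq.le
    rw [hc, div_mul_eq_mul_div, le_div_iff₀ hνmin]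
    calc t * p.νmin ≤ 2 / β * sδ * p.νmin := by
          refine mul_le_mul_of_nonneg_right (ht.trans ?_) hνmin.le
          exact mul_le_mul_of_nonneg_left h1 (by positivity)
      _ = 2 / β * (p.νmin * sδ) := by ring
      _ ≤ _ := mul_le_mul_of_nonneg_left hμmin (by positivity)
  set b := L₁ * t ^ 2 + μ * t with hb
  have hb0 : 0 ≤ b := by positivity
  have hbμ : b ≤ (L₁ * c + 1) * (μ * t) := by
    calc b = L₁ * t * t + μ * t := by rw [hb]; ring
      _ ≤ L₁ * t * (c * μ) + μ * t := by gcongr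
      _ = _ := by ring
  set e := ‖P.R p.a μ x y‖
  have he0 : 0 ≤ e := norm_nonneg _
  have hBK : (1 + Γ) * e + b ≤ K * (μ * t) := by
    have := mul_le_mul_of_nonneg_left he (by linarith : 0 ≤ 1 + Γ)
    rw [hK]
    linarith
  have hquad := hB.mul_sq_norm_sub_le hφ p.ha hμ0.le hx hz y (b := b) le_rfl
  have hquad' : μ * ‖y - z‖ ^ 2 ≤ ‖y - z‖ * ((1 + Γ) * e + b) + b * e := by
    have h1 : (1 + ‖P.G p.a μ x‖) * e + b ≤ (1 + Γ) * e + b := by gcongr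
    have := mul_le_mul_of_nonneg_left h1 (norm_nonneg (y - z))
    linarith
  have hU := mul_le_of_mul_sq_le hμbar (norm_nonneg (y - z)) (by positivity) hνbar.le
    (by
      have h0 := mul_nonneg hΓ0 he0
      have h1 : e ≤ (1 + Γ) * e + b := by linarith
      have h2 : b ≤ (1 + Γ) * e + b := by linarith
      rw [sq]
      exact mul_le_mul h2 h1 he0 (by positivity)) hquad'
  have hU' : ‖y - z‖ ≤ (1 + p.νbar) * K * t := by
    refine le_of_mul_le_mul_left (hU.trans ?_) hμ0
    calc _ ≤ (1 + p.νbar) * (K * (μ * t)) := mul_le_mul_of_nonneg_left hBK (by positivity)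
      _ = _ := by ring
  have htri : ‖y - x‖ ≤ ‖y - z‖ + t := by
    have := norm_sub_le_norm_sub_add_norm_sub y z x
    rwa [norm_sub_rev z x] at this
  linarith

/-- Close to a strongly stationary point with the error bound, an inexact subproblem solution is
accepted, reduces the residual superlinearly and is close to the current iterate. -/
lemma LocalBounds.eventually_successful (hB : P.LocalBounds p.a xs ε L M)
    (hP : P.StandingAssumptions)
    (hφ : IsClosedConvexFun P.φ) (hε : 0 < ε) (hxs : xs ∈ P.stronglyStationary)
    (hβ : 0 < β) (hq : p.δ < q) (hq' : 1 - p.δ < q)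
    (hEB : ∀ y ∈ Metric.ball xs ε ∩ effDom P.φ,
      β * Metric.infDist y P.stronglyStationary ≤ ‖P.r y‖ ^ q) :
    ∃ C > 0, ∀ᶠ s in 𝓝[>] (0 : ℝ), ∀ (x y : EuclideanSpace ℝ (Fin n)) (ν : ℝ),
      x ∈ effDom P.φ → dist x xs < ε / 4 → ‖P.r x‖ = s → p.νmin ≤ ν → ν ≤ p.νbar →
      InexactSolution P p (ν * ‖P.r x‖ ^ p.δ) x y →
      ¬ Unsuccessful P p x y ∧ ‖P.r y‖ ≤ C * ‖P.r x‖ ^ min (1 + p.τ) (p.δ + q) ∧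
        ‖P.r y‖ ≤ p.η * ‖P.r x‖ ∧ ‖y - x‖ ≤ C * ‖P.r x‖ ^ q := by
  obtain ⟨C₂, Γ, hC₂, hΓ, hstep⟩ := hB.exists_norm_step_le hφ hε hβ hq
  have hL := hB.L_nonneg
  have hνmin := p.hν.1
  have hνbar : 0 < p.νbar := by linarith [p.hν.2.1, p.hν.2.2]
  have hc₁ : 0 < (1 - p.c₁) / 2 := by linarith [p.hc₁.2]
  have hτ : 0 < p.τ := p.hδ.1.trans_le p.hτ
  set ρ := min (1 + p.τ) (p.δ + q) with hρ
  have hρ1 : 1 < ρ := lt_min (by linarith) (by linarith)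
  set C₃ := C₂ * (2 / β) with hC₃
  set C₄ := 1 + L * C₃ ^ 2 + L * ‖P.A‖ ^ 2 * (2 / β) * C₃ + p.νbar * C₃ with hC₄
  have hC₃0 : 0 ≤ C₃ := by positivity
  have hC₄0 : 0 < C₄ := by positivity
  refine ⟨C₃ + C₄, by positivity, ?_⟩
  -- The four smallness conditions serve, in order: to keep `y` in the ball, to pass the ratio test,
  -- to pass the `pred` test, and to reduce the residual by `η`.
  filter_upwards [self_mem_nhdsWithin, Ioo_mem_nhdsGT (zero_lt_one (α := ℝ)),
    eventually_mul_rpow_lt C₃ (p.hδ.1.trans hq) (half_pos hε),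
    eventually_mul_rpow_lt (L * (C₃ / p.νmin)) (sub_pos.mpr hq) hc₁,
    eventually_mul_rpow_lt p.pmin (show 0 < p.κ - (1 + p.δ) by linarith [p.hκ])
      (show 0 < 1 / 2 * p.νmin / (2 + Γ) by positivity),
    eventually_mul_rpow_lt C₄ (sub_pos.mpr hρ1) p.hη.1] with s hs hs1 hsm1 hsm2 hsm3 hsm4
  rintro x y ν hxd hxε rfl hν1 hν2 hy
  have hs : 0 < ‖P.r x‖ := hs
  have hs1 : ‖P.r x‖ ≤ 1 := hs1.2.le
  have hxS : x ∈ Metric.ball xs ε ∩ effDom P.φ := ⟨by rw [Metric.mem_ball]; linarith, hxd⟩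
  obtain ⟨z, hz, htε, ht⟩ := hB.exists_near_stronglyStationary hφ hε hxs hβ hEB hxd hxε hs
  obtain ⟨hd, hG⟩ := hstep x hxS z hz ν y hs hs1 htε ht hν1 hν2 hy
  have hyd := hP.mem_effDom_of_inexactSolution hxd hy
  have hΛ0 := Lam_nonneg (P := P) p.ha x
  have hΛt := hB.Lam_le x hxS z hz
  have hθr := one_sub_mul_norm_r_le hφ hy
  set s := ‖P.r x‖ with hsdef
  set d := ‖y - x‖ with hdd
  have hsδ0 : 0 < s ^ p.δ := Real.rpow_pos_of_pos hs _
  set μ := ν * s ^ p.δ with hμ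
  have hμ0 : 0 < μ := by have : 0 < ν := by linarith
                         positivity
  have hμmin : p.νmin * s ^ p.δ ≤ μ := mul_le_mul_of_nonneg_right hν1 hsδ0.le
  have hμbar : μ ≤ p.νbar * s ^ p.δ := mul_le_mul_of_nonneg_right hν2 hsδ0.le
  have hd3 : d ≤ C₃ * s ^ q :=
    hd.trans (by rw [hC₃, mul_assoc]; exact mul_le_mul_of_nonneg_left ht hC₂)
  have hd0 : 0 < d := by
    have h1 : 0 < (1 - p.θ) * s := mul_pos (by linarith [p.hθ.2]) hs
    by_contra! h
    have h2 : d = 0 := le_antisymm h (norm_nonneg _)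
    rw [h2, mul_zero] at hθr
    linarith
  have hyS : y ∈ Metric.ball xs ε ∩ effDom P.φ := by
    refine ⟨?_, hyd⟩
    have h1 := dist_triangle y x xs
    rw [dist_eq_norm y x] at h1
    rw [Metric.mem_ball]
    linarith
  have hpred := hP.half_mul_sq_le_pred hμ0.le hxd hy
  have hpred0 : 0 < P.pred x y := lt_of_lt_of_le (by positivity) hpred
  have hsq0 : 0 < s ^ q := Real.rpow_pos_of_pos hs _
  have hsδq : s ^ p.δ * s ^ q ≤ s ^ ρ := by
    rw [← Real.rpow_add hs]
    exact Real.rpow_le_rpow_of_exponent_ge hs hs1 (min_le_right _ _)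
  have hsqδ : s ^ q ≤ s ^ p.δ := Real.rpow_le_rpow_of_exponent_ge hs hs1 hq.le
  have hres : ‖P.r y‖ ≤ C₄ * s ^ ρ := by
    have h1 := hB.norm_r_candidate_le hφ p.ha hμ0.le hxS hyS
    have h2 : ‖P.R p.a μ x y‖ ≤ s ^ ρ :=
      (hy.1.trans ((mul_le_of_le_one_left (le_min hs.le (Real.rpow_nonneg hs.le _))
        p.hθ.2.le).trans (min_le_right _ _))).trans
        (Real.rpow_le_rpow_of_exponent_ge hs hs1 (min_le_left _ _))
    -- Terms of order `s ^ (2 * q)` are dominated by `s ^ (δ + q)`.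
    have hqq : s ^ q * s ^ q ≤ s ^ ρ := (mul_le_mul_of_nonneg_right hsqδ hsq0.le).trans hsδq
    have h3 : L * d ^ 2 ≤ L * C₃ ^ 2 * s ^ ρ := by
      have h4 : d ^ 2 ≤ (C₃ * s ^ q) ^ 2 := pow_le_pow_left₀ hd0.le hd3 2
      calc L * d ^ 2 ≤ L * (C₃ * s ^ q) ^ 2 := mul_le_mul_of_nonneg_left h4 hL
        _ = L * C₃ ^ 2 * (s ^ q * s ^ q) := by ring
        _ ≤ _ := mul_le_mul_of_nonneg_left hqq (by positivity)
    have h5 : P.Lam p.a x * ‖P.A‖ ^ 2 * d ≤ L * ‖P.A‖ ^ 2 * (2 / β) * C₃ * s ^ ρ := by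
      calc P.Lam p.a x * ‖P.A‖ ^ 2 * d
          ≤ L * (2 / β * s ^ q) * ‖P.A‖ ^ 2 * (C₃ * s ^ q) := by
            gcongr
            exact hΛt.trans (mul_le_mul_of_nonneg_left ht hL)
        _ = L * ‖P.A‖ ^ 2 * (2 / β) * C₃ * (s ^ q * s ^ q) := by ring
        _ ≤ _ := mul_le_mul_of_nonneg_left hqq (by positivity)
    have h6 : μ * d ≤ p.νbar * C₃ * s ^ ρ := by
      calc μ * d ≤ p.νbar * s ^ p.δ * (C₃ * s ^ q) := by gcongr
        _ = p.νbar * C₃ * (s ^ p.δ * s ^ q) := by ring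
        _ ≤ _ := mul_le_mul_of_nonneg_left hsδq (by positivity)
    rw [hC₄]
    linarith
  refine ⟨?_, ?_, ?_, ?_⟩
  · rintro (hun | hun)
    -- Since `μ * s` is at least of order `s ^ (1 + δ)` and `κ > 1 + δ`, the threshold is of higher
    -- order than the lower bound for `pred`.
    · have h1 : p.pmin * s ^ p.κ < 1 / 2 * μ * s / (2 + Γ) := by
        have e1 : s ^ p.κ = s ^ (p.κ - (1 + p.δ)) * (s * s ^ p.δ) := by
          rw [← Real.rpow_one_add' hs.le (by linarith [p.hδ.1]), ← Real.rpow_add hs]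
          congr 1; ring
        have h2 : 0 < s * s ^ p.δ := by positivity
        calc p.pmin * s ^ p.κ = p.pmin * s ^ (p.κ - (1 + p.δ)) * (s * s ^ p.δ) := by
              rw [e1]; ring
          _ < 1 / 2 * p.νmin / (2 + Γ) * (s * s ^ p.δ) := mul_lt_mul_of_pos_right hsm3 h2
          _ = 1 / 2 * (p.νmin * s ^ p.δ) * s / (2 + Γ) := by ring
          _ ≤ _ := by gcongr
      have h3 : (1 - p.θ) * s ≤ (2 + Γ) * d := hθr.trans (by gcongr)
      have h1θ : 0 < 1 - p.θ := by linarith [p.hθ.2]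
      have hpm := p.hpmin.1
      have h4 : p.pmin * (1 - p.θ) * d * min s (s ^ p.κ) < 1 / 2 * μ * d ^ 2 := by
        calc p.pmin * (1 - p.θ) * d * min s (s ^ p.κ)
            ≤ p.pmin * (1 - p.θ) * d * s ^ p.κ :=
              mul_le_mul_of_nonneg_left (min_le_right _ _) (by positivity)
          _ = (p.pmin * s ^ p.κ) * ((1 - p.θ) * d) := by ring
          _ < (1 / 2 * μ * s / (2 + Γ)) * ((1 - p.θ) * d) :=
              mul_lt_mul_of_pos_right h1 (by positivity)
          _ = 1 / 2 * μ * d / (2 + Γ) * ((1 - p.θ) * s) := by ring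
          _ ≤ 1 / 2 * μ * d / (2 + Γ) * ((2 + Γ) * d) :=
              mul_le_mul_of_nonneg_left h3 (by positivity)
          _ = _ := by field_simp
      linarith
    · rw [div_le_iff₀ hpred0] at hun
      have h1 := le_of_abs_le (hB.abs_pred_sub_ared_le hP hxS hyS)
      -- The ratio `d / μ` is `O(s ^ (q - δ))`, which makes the cubic model error small against `μ *
      -- d ^ 2`.
      have h2 : L * d < (1 - p.c₁) / 2 * μ := by
        have e1 : s ^ q = s ^ (q - p.δ) * s ^ p.δ := by rw [← Real.rpow_add hs]; congr 1; ring
        have h3 : d ≤ C₃ / p.νmin * s ^ (q - p.δ) * μ := by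
          have h4 := Real.rpow_nonneg hs.le (q - p.δ)
          calc d ≤ C₃ * s ^ q := hd3
            _ = C₃ / p.νmin * s ^ (q - p.δ) * (p.νmin * s ^ p.δ) := by rw [e1]; field_simp
            _ ≤ _ := mul_le_mul_of_nonneg_left hμmin (by positivity)
        calc L * d ≤ L * (C₃ / p.νmin * s ^ (q - p.δ) * μ) := mul_le_mul_of_nonneg_left h3 hL
          _ = L * (C₃ / p.νmin) * s ^ (q - p.δ) * μ := by ring
          _ < _ := mul_lt_mul_of_pos_right hsm2 hμ0
      have h5 : L * d ^ 3 < (1 - p.c₁) * (1 / 2 * μ * d ^ 2) := by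
        have := mul_lt_mul_of_pos_right h2 (pow_pos hd0 2)
        linarith
      have h6 := mul_le_mul_of_nonneg_left hpred (show 0 ≤ 1 - p.c₁ by linarith)
      linarith
  · exact hres.trans (mul_le_mul_of_nonneg_right (by linarith) (Real.rpow_nonneg hs.le _))
  · refine hres.trans ?_
    have e1 : s ^ ρ = s ^ (ρ - 1) * s := by
      rw [← Real.rpow_add_one hs.ne']; congr 1; ring
    rw [e1, ← mul_assoc]
    exact mul_le_mul_of_nonneg_right hsm4.le hs.le
  · exact hd3.trans (mul_le_mul_of_nonneg_right (by linarith) hsq0.le)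

end StepBound

end CompositeProblem

/-! ### Properties of the generated sequences -/

section Run

variable {n m : ℕ} {P : CompositeProblem n m} {p : IRPNMParams}
  {x xhat : ℕ → EuclideanSpace ℝ (Fin n)} {ν rbar μ : ℕ → ℝ}

lemma CompositeProblem.StandingAssumptions.isClosedConvexFun (hP : P.StandingAssumptions)
    {z : EuclideanSpace ℝ (Fin n)} (hz : z ∈ P.stronglyStationary) : IsClosedConvexFun P.φ := by
  obtain ⟨-, v, hv, -⟩ := hz.1
  exact ⟨hP.φ_proper, hP.φ_lsc, hP.φ_convex, z, v, hv⟩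

namespace IsIRPNMRun

lemma mem_effDom (hrun : IsIRPNMRun P p x xhat ν rbar μ) (hP : P.StandingAssumptions) (k : ℕ) :
    x k ∈ effDom P.φ := by
  induction k with
  | zero => exact hrun.x_zero
  | succ k ih =>
    rw [hrun.x_succ]
    split_ifs
    · exact ih
    · exact hP.mem_effDom_of_inexactSolution ih (hrun.xhat_inexact k)

lemma νmin_le (hrun : IsIRPNMRun P p x xhat ν rbar μ) (k : ℕ) : p.νmin ≤ ν k := by
  have hbar : p.νmin ≤ p.νbar := p.hν.2.1.trans p.hν.2.2
  induction k with
  | zero => rw [hrun.ν_zero]; exact p.hν.2.1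
  | succ k ih =>
    rw [hrun.ν_succ]
    split_ifs
    · exact ih.trans (le_mul_of_one_le_left (p.hν.1.le.trans ih) p.hσ₂.le)
    · exact le_min ih hbar
    · exact le_min (le_max_right _ _) hbar

lemma succ_mem_indexK_iff (k : ℕ) :
    k + 1 ∈ indexK P p x rbar ↔ ‖P.r (x (k + 1))‖ ≤ p.η * rbar k := by
  constructor
  · rintro (h | ⟨j, hj, h⟩)
    · exact absurd h (Nat.succ_ne_zero k)
    · obtain rfl : k = j := by omega
      exact h
  · exact fun h => Or.inr ⟨k, rfl, h⟩

lemma rbar_eq_of_mem_indexK (hrun : IsIRPNMRun P p x xhat ν rbar μ) {k : ℕ}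
    (hk : k ∈ indexK P p x rbar) : rbar k = ‖P.r (x k)‖ := by
  cases k with
  | zero => exact hrun.rbar_zero
  | succ k => rw [hrun.rbar_succ, if_pos ((succ_mem_indexK_iff k).mp hk)]

/-- At an iterate whose residual is below `η r̄` the residual vanishes. -/
lemma r_eq_zero_of_norm_le (hrun : IsIRPNMRun P p x xhat ν rbar μ) {k : ℕ}
    (h : ‖P.r (x k)‖ ≤ p.η * rbar k) : ‖P.r (x k)‖ = 0 := by
  by_cases hk : k ∈ indexK P p x rbar
  · rw [hrun.rbar_eq_of_mem_indexK hk] at h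
    have h0 := norm_nonneg (P.r (x k))
    have h1 := p.hη.2
    nlinarith
  -- Outside `𝒦` the value `r̄` was carried over from the previous index, so the hypothesis is
  -- exactly the condition that would put the index in `𝒦`.
  · cases k with
    | zero => exact absurd (Or.inl rfl) hk
    | succ k =>
      rw [succ_mem_indexK_iff] at hk
      rw [hrun.rbar_succ, if_neg hk] at h
      exact absurd h hk

/-- The regularization parameter is bounded at the indices with sufficient residual decrease. -/
lemma le_νbar_of_mem_indexK (hrun : IsIRPNMRun P p x xhat ν rbar μ) {k : ℕ}
    (hk : k ∈ indexK P p x rbar) (hr : ‖P.r (x k)‖ ≠ 0) : ν k ≤ p.νbar := by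
  cases k with
  | zero => rw [hrun.ν_zero]; exact p.hν.2.2
  | succ k =>
    have hk' := (succ_mem_indexK_iff k).mp hk
    rw [hrun.ν_succ]
    split_ifs with hun
    -- After a rejection the iterate is unchanged, so it already met the decrease test one index
    -- earlier and its residual is zero.
    · have hx : x (k + 1) = x k := by rw [hrun.x_succ, if_pos hun]
      rw [hx] at hk' hr
      exact absurd (hrun.r_eq_zero_of_norm_le hk') hr
    · exact min_le_right _ _
    · exact min_le_right _ _

end IsIRPNMRun

/-- One step of the method, started close to a strongly stationary point at an index with
sufficient residual decrease. -/
lemma IsIRPNMRun.exists_step_bound (hrun : IsIRPNMRun P p x xhat ν rbar μ)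
    (hP : P.StandingAssumptions) {xs : EuclideanSpace ℝ (Fin n)} (hxs : xs ∈ P.stronglyStationary)
    {ε L M β q : ℝ} (hε : 0 < ε) (hB : P.LocalBounds p.a xs ε L M) (hβ : 0 < β)
    (hq : p.δ < q) (hq' : 1 - p.δ < q)
    (hEB : ∀ y ∈ Metric.ball xs ε ∩ effDom P.φ,
      β * Metric.infDist y P.stronglyStationary ≤ ‖P.r y‖ ^ q) :
    ∃ C > 0, ∀ᶠ s in 𝓝[>] (0 : ℝ), ∀ k ∈ indexK P p x rbar, dist (x k) xs < ε / 4 →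
      (‖P.r (x k)‖ = s ∨ ‖P.r (x k)‖ = 0) →
      k + 1 ∈ indexK P p x rbar ∧
        ‖P.r (x (k + 1))‖ ≤ C * ‖P.r (x k)‖ ^ min (1 + p.τ) (p.δ + q) ∧
        ‖P.r (x (k + 1))‖ ≤ p.η * ‖P.r (x k)‖ ∧
        dist (x k) (x (k + 1)) ≤ C * ‖P.r (x k)‖ ^ q := by
  have hφ := hP.isClosedConvexFun hxs
  obtain ⟨C, hC, hev⟩ := hB.eventually_successful hP hφ hε hxs hβ hq hq' hEB
  refine ⟨C, hC, ?_⟩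
  filter_upwards [hev, self_mem_nhdsWithin] with s hs hs0 k hk hkε hks
  have hs0 : 0 < s := hs0
  have hxd := hrun.mem_effDom hP k
  have hrb := hrun.rbar_eq_of_mem_indexK hk
  have hin := hrun.xhat_inexact k
  have hq0 : 0 < q := p.hδ.1.trans hq
  rw [IsIRPNMRun.succ_mem_indexK_iff, hrb]
  rcases hks with hks | hks
  · rw [hrun.μ_eq, hrb] at hin
    obtain ⟨h1, h2, h3, h4⟩ := hs (x k) (xhat k) (ν k) hxd hkε hks (hrun.νmin_le k)
      (hrun.le_νbar_of_mem_indexK hk (hks ▸ hs0.ne')) hin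
    rw [hrun.x_succ, if_neg h1, dist_comm, dist_eq_norm]
    exact ⟨h3, h2, h3, h4⟩
  · have hxb : x k ∈ Metric.ball xs ε ∩ effDom P.φ :=
      ⟨by rw [Metric.mem_ball]; linarith, hxd⟩
    have h1 := hEB (x k) hxb
    rw [hks, Real.zero_rpow hq0.ne'] at h1
    have h2 : Metric.infDist (x k) P.stronglyStationary ≤ 0 := nonpos_of_mul_nonpos_right h1 hβ
    have hun := hB.unsuccessful_of_r_eq_zero hP hφ p hxb
      (hP.mem_effDom_of_inexactSolution hxd hin) (norm_eq_zero.mp hks) ⟨xs, hxs⟩ h2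
    rw [hrun.x_succ, if_pos hun, hks, dist_self, mul_zero]
    exact ⟨le_rfl, by positivity, le_rfl, by positivity⟩

end Run

/-! ### Convergence of the iterates and superlinear rate -/

lemma one_lt_min_exponents (p : IRPNMParams) {q : ℝ} (hq' : 1 - p.δ < q) :
    1 < min (1 + p.τ) (p.δ + q) :=
  lt_min (by linarith [p.hδ.1, p.hτ]) (by linarith)

theorem mainTheorem4 {n m : ℕ} (P : CompositeProblem n m) (hP : P.StandingAssumptions)
    (p : IRPNMParams)
    (x xhat : ℕ → EuclideanSpace ℝ (Fin n)) (ν rbar μ : ℕ → ℝ)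
    (hrun : IsIRPNMRun P p x xhat ν rbar μ)
    -- some accumulation point of the subsequence indexed by `𝒦` is strongly stationary
    (xstar : EuclideanSpace ℝ (Fin n)) (hxstar : xstar ∈ P.stronglyStationary)
    (hacc : MapClusterPt xstar (atTop ⊓ 𝓟 (indexK P p x rbar)) x)
    (ε : ℝ) (hε : 0 < ε)
    -- local Lipschitz continuity of the Hessian of `ψ`
    (Lψ : ℝ) (hLψ : 0 < Lψ)
    (hLip : ∀ y ∈ Metric.ball xstar ε ∩ effDom P.φ, ∀ z ∈ Metric.ball xstar ε ∩ effDom P.φ,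
      ‖P.hessψ y - P.hessψ z‖ ≤ Lψ * ‖P.A y - P.A z‖)
    -- local Hölderian error bound
    (β q : ℝ) (hβ : 0 < β) (hq : max p.δ (1 - p.δ) < q)
    (hEB : ∀ y ∈ Metric.ball xstar ε ∩ effDom P.φ,
      β * Metric.infDist y P.stronglyStationary ≤ ‖P.r y‖ ^ q) :
    Tendsto x atTop (𝓝 xstar) ∧
      Tendsto (fun k => ‖P.r (x k)‖) atTop (𝓝 0) ∧
      1 < min (1 + p.τ) (p.δ + q) ∧
      ∃ C : ℝ, 0 < C ∧ ∀ᶠ k in atTop,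
        ‖P.r (x (k + 1))‖ ≤ C * ‖P.r (x k)‖ ^ min (1 + p.τ) (p.δ + q) := by
  obtain ⟨hq1, hq2⟩ := max_lt_iff.mp hq
  have hq0 : 0 < q := p.hδ.1.trans hq1
  have hφ := hP.isClosedConvexFun hxstar
  obtain ⟨L, M, hB⟩ := hP.exists_localBounds p.ha hxstar.1.1 hε hLψ hLip
  obtain ⟨C, hC, hev⟩ := hrun.exists_step_bound hP hxstar hε hB hβ hq1 hq2 hEB
  set γ := p.η ^ q with hγ
  have hγ0 : 0 ≤ γ := Real.rpow_nonneg p.hη.1.le _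
  have hγ1 : γ < 1 := Real.rpow_lt_one p.hη.1.le p.hη.2 hq0
  have hγ' : 0 < 1 - γ := by linarith
  -- `C * s ^ q / (1 - γ)` is the sum of all later step bounds. Together with the initial distance
  -- `ε / 8` it stays below the radius `ε / 4`.
  obtain ⟨s₁, hs₁, hsub⟩ := mem_nhdsGT_iff_exists_Ioo_subset.mp (hev.and
    (CompositeProblem.eventually_mul_rpow_lt (C / (1 - γ)) hq0 (show 0 < ε / 8 by positivity)))
  have hs₁ : 0 < s₁ := hs₁
  have hM2 : 0 < 2 + M := by linarith [hB.M_nonneg]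
  -- an index at which the iterate is close to the accumulation point
  obtain ⟨k₀, hk₀, hk₀d⟩ : ∃ k ∈ indexK P p x rbar,
      dist (x k) xstar < min (ε / 8) (s₁ / (2 + M)) := by
    have h := mapClusterPt_iff_frequently.mp hacc (Metric.ball xstar (min (ε / 8) (s₁ / (2 + M))))
      (Metric.ball_mem_nhds _ (by positivity))
    rw [frequently_inf_principal] at h
    obtain ⟨k, hk1, hk2⟩ := h.exists
    exact ⟨k, hk1, hk2⟩
  have hr₀ : ‖P.r (x k₀)‖ < s₁ := by
    have h1 := hB.norm_r_le hφ (x := x k₀)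
      ⟨by rw [Metric.mem_ball]; linarith [hk₀d.trans_le (min_le_left _ _)],
        hrun.mem_effDom hP k₀⟩ ⟨Metric.mem_ball_self hε, hxstar⟩
    have h2 := hk₀d.trans_le (min_le_right _ _)
    rw [lt_div_iff₀ hM2, dist_eq_norm] at h2
    linarith
  set s := ‖P.r (x k₀)‖ with hs
  have hs0 : 0 ≤ s := norm_nonneg _
  have hCs : C * s ^ q / (1 - γ) < ε / 8 := by
    rcases hs0.eq_or_lt with h | h
    · rw [← h, Real.zero_rpow hq0.ne', mul_zero, zero_div]; positivity
    · have := (hsub ⟨h, hr₀⟩).2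
      rwa [div_mul_eq_mul_div] at this
  have hstep : ∀ k ∈ indexK P p x rbar, dist (x k) xstar < ε / 4 → ‖P.r (x k)‖ < s₁ →
      k + 1 ∈ indexK P p x rbar ∧
        ‖P.r (x (k + 1))‖ ≤ C * ‖P.r (x k)‖ ^ min (1 + p.τ) (p.δ + q) ∧
        ‖P.r (x (k + 1))‖ ≤ p.η * ‖P.r (x k)‖ ∧
        dist (x k) (x (k + 1)) ≤ C * ‖P.r (x k)‖ ^ q := by
    intro k hk hkε hks
    rcases (norm_nonneg (P.r (x k))).eq_or_lt with h | h
    -- For zero residual the value of `s` is immaterial; `s₁ / 2` is an arbitrary admissible choice.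
    · exact (hsub (show s₁ / 2 ∈ Set.Ioo 0 s₁ from ⟨by positivity, by linarith⟩)).1 k hk hkε
        (Or.inr h.symm)
    · exact (hsub ⟨h, hks⟩).1 k hk hkε (Or.inl rfl)
  have hgeom : ∀ j t : ℝ, 0 ≤ j → 0 ≤ t → t ≤ j * s → C * t ^ q ≤ C * s ^ q * j ^ q := by
    intro j t hj ht h
    rw [mul_assoc, mul_comm (s ^ q), ← Real.mul_rpow hj hs0]
    exact mul_le_mul_of_nonneg_left (Real.rpow_le_rpow ht h hq0.le) hC.le
  have hpow : ∀ j : ℕ, (p.η ^ j) ^ q = γ ^ j := fun j => by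
    rw [hγ, ← Real.rpow_natCast, ← Real.rpow_natCast, ← Real.rpow_mul p.hη.1.le,
      ← Real.rpow_mul p.hη.1.le, mul_comm]
  have hηj : ∀ j : ℕ, 0 ≤ p.η ^ j := fun j => pow_nonneg p.hη.1.le j
  -- The distance is bounded by the exact partial geometric sum, so that the induction closes
  -- without losing constants.
  have hinv : ∀ j : ℕ, k₀ + j ∈ indexK P p x rbar ∧ ‖P.r (x (k₀ + j))‖ ≤ p.η ^ j * s ∧
      dist (x k₀) (x (k₀ + j)) ≤ C * s ^ q / (1 - γ) * (1 - γ ^ j) := by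
    intro j
    induction j with
    | zero => simpa using ⟨hk₀, hs.ge⟩
    | succ j ih =>
      obtain ⟨h1, h2, h3⟩ := ih
      have hD0 : 0 ≤ C * s ^ q / (1 - γ) := by positivity
      have h4 : C * s ^ q / (1 - γ) * (1 - γ ^ j) ≤ C * s ^ q / (1 - γ) :=
        mul_le_of_le_one_right hD0 (by linarith [pow_nonneg hγ0 j])
      have h5 : dist (x (k₀ + j)) xstar < ε / 4 := by
        have := dist_triangle_left (x (k₀ + j)) xstar (x k₀)
        have := hk₀d.trans_le (min_le_left _ _)
        linarith
      have h6 : ‖P.r (x (k₀ + j))‖ < s₁ :=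
        (h2.trans (mul_le_of_le_one_left hs0 (pow_le_one₀ p.hη.1.le p.hη.2.le))).trans_lt hr₀
      obtain ⟨g1, -, g3, g4⟩ := hstep _ h1 h5 h6
      refine ⟨g1, ?_, ?_⟩
      · refine g3.trans ?_
        rw [pow_succ', mul_assoc]
        exact mul_le_mul_of_nonneg_left h2 p.hη.1.le
      · have h7 := hgeom _ _ (hηj j) (norm_nonneg _) h2
        rw [hpow] at h7
        have h8 := dist_triangle (x k₀) (x (k₀ + j)) (x (k₀ + j + 1))
        have h9 : C * s ^ q / (1 - γ) * (1 - γ ^ (j + 1)) =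
            C * s ^ q / (1 - γ) * (1 - γ ^ j) + C * s ^ q * γ ^ j := by
          field_simp
          ring
        rw [← add_assoc, h9]
        linarith
  have hnear : ∀ j : ℕ, dist (x (k₀ + j)) xstar < ε / 4 ∧ ‖P.r (x (k₀ + j))‖ < s₁ := by
    intro j
    obtain ⟨-, h2, h3⟩ := hinv j
    have h4 : C * s ^ q / (1 - γ) * (1 - γ ^ j) ≤ C * s ^ q / (1 - γ) :=
      mul_le_of_le_one_right (by positivity) (by linarith [pow_nonneg hγ0 j])
    have h5 := dist_triangle_left (x (k₀ + j)) xstar (x k₀)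
    have h6 := hk₀d.trans_le (min_le_left _ _)
    exact ⟨by linarith,
      (h2.trans (mul_le_of_le_one_left hs0 (pow_le_one₀ p.hη.1.le p.hη.2.le))).trans_lt hr₀⟩
  have hcauchy : CauchySeq (fun j => x (j + k₀)) := by
    refine cauchySeq_of_le_geometric γ (C * s ^ q) hγ1 fun j => ?_
    obtain ⟨h1, h2, -⟩ := hinv j
    have h3 := (hstep _ h1 (hnear j).1 (hnear j).2).2.2.2
    have h4 := hgeom _ _ (hηj j) (norm_nonneg _) h2
    rw [hpow] at h4
    rw [add_comm j k₀, show j + 1 + k₀ = k₀ + j + 1 by ring]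
    exact h3.trans h4
  obtain ⟨y, hy⟩ := cauchySeq_tendsto_of_complete hcauchy
  have hy' : Tendsto x atTop (𝓝 y) := (tendsto_add_atTop_iff_nat k₀).mp hy
  have hyx : xstar = y := by
    have h1 : MapClusterPt xstar atTop x := hacc.mono inf_le_left
    exact eq_of_nhds_neBot (ClusterPt.mono h1 hy')
  refine ⟨hyx ▸ hy', ?_, one_lt_min_exponents p hq2, C, hC, ?_⟩
  · refine (tendsto_add_atTop_iff_nat k₀).mp ?_
    have h1 : Tendsto (fun j : ℕ => p.η ^ j * s) atTop (𝓝 (0 * s)) :=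
      (tendsto_pow_atTop_nhds_zero_of_lt_one p.hη.1.le p.hη.2).mul_const s
    rw [zero_mul] at h1
    refine squeeze_zero (fun _ => norm_nonneg _) (fun j => ?_) h1
    rw [add_comm]
    exact (hinv j).2.1
  · filter_upwards [eventually_ge_atTop k₀] with k hk
    obtain ⟨j, rfl⟩ := Nat.exists_eq_add_of_le hk
    exact (hstep _ (hinv j).1 (hnear j).1 (hnear j).2).2.1
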